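/- **Theorem (string equations of the $p$-th generalized Kontsevich model).** Let $p\ge 1$ be an integer, $\hbar>0$, and let $\kappa\ne 0$ be a real constant. For $j\in\mathbb Z$, $\epsilon>0$ and $\lambda>0$ put $$u_j(\lambda)=c(\lambda)\int_\epsilon^\infty \mu^{-j-1}\exp\Bigl(\hbar^{-1}\bigl(\lambda^p\mu-\tfrac{1}{p+1}\mu^{p+1}\bigr)\Bigr)d\mu,\qquad c(\lambda)=\kappa\,\lambda^{(p-1)/2}\exp\Bigl(-\hbar^{-1}\tfrac{p}{p+1}\lambda^{p+1}\Bigr).$$ (a) For all $j\in\mathbb Z$ the integral converges and there is an asymptotic expansion $u_j(\lambda)\sim\sum_{i\ge j}u_{ij}\lambda^{-i-1}$ as $\lambda\to+\infty$, with coefficients $u_{ij}$ that do not depend on the cut-off $\epsilon$. If $p$ is odd and $j<0$, the same expansion holds for the integral over the whole real line. Put $u_{ij}=0$ for $i<j$ and let $U=(u_{ij})_{i,j\in\mathbb Z}$, a lower triangular matrix, which is uniquely determined by these expansions for any one $\epsilon>0$. (b) Let $\Lambda=(\delta_{i,j-1})$ and $\Delta=(i\,\delta_{ij})$ ($i,j\in\mathbb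 Z$). Then $$\Lambda^pU=U(\hbar\Delta\Lambda^{-1}+\Lambda^p),\qquad U\Lambda=\Bigl(-\tfrac{\hbar}{p}\Delta\Lambda^{-p}+\hbar\tfrac{p-1}{2p}\Lambda^{-p}+\Lambda\Bigr)U.$$ (c) Let $\mathcal A$ be the ring of formal power series in the commuting times $t=(t_1,t_2,\dots)$, $\bar t=(\bar t_1,\bar t_2,\dots)$, with coefficients in the ring of real $\mathbb Z\times\mathbb Z$ matrices that have only finitely many nonzero superdiagonals. There is exactly one pair of invertible elements $W,\bar W$ of $\mathcal A$ such that $W$ is lower triangular with diagonal entries $1$, $\bar W$ and $\bar W^{-1}$ are upper triangular, the flow equations of the $\hbar$-dependent Toda lattice hierarchy $$\hbar\tfrac{\partial W}{\partial t_n}=-(L^n)_{<0}W,\quad \hbar\tfrac{\partial W}{\partial\bar t_n}=(\bar L^{-n})_{<0}W,\quad \hbar\tfrac{\partial\bar W}{\partial t_n}=(L^n)_{\ge0}\bar W,\quad \hbar\tfrac{\partial\bar W}{\partial\bar t_n}=-(\bar L^{-n})_{\ge0}\bar W\qquad(n\ge1)$$ hold with $L=W\Lambda W^{-1}$, $\bar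 L=\bar W\Lambda\bar W^{-1}$, and $W^{-1}\bar W=U$ at $t=\bar t=0$. Here $(\cdot)_{\ge0}$ and $(\cdot)_{<0}$ denote the upper triangular part (with the diagonal) and the strictly lower triangular part. (d) The Lax operators $L,\bar L$ and the Orlov–Shulman operators $$M=W\Bigl(\hbar\Delta+\sum_{n\ge1}n t_n\Lambda^n\Bigr)W^{-1},\qquad \bar M=\bar W\Bigl(\hbar\Delta-\sum_{n\ge1}n\bar t_n\Lambda^{-n}\Bigr)\bar W^{-1}$$ of this solution obey the string equations $$L^p=\bar M\bar L^{-1}+\bar L^p,\qquad \bar L=-\tfrac1p ML^{-p}+\hbar\tfrac{p-1}{2p}L^{-p}+L.$$ -/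

import Mathlib

open Filter Asymptotics MeasureTheory

noncomputable section

namespace Toda

/-! ## Infinite matrices -/

/-- Real `ℤ × ℤ` matrices with only finitely many nonzero superdiagonals, that is, formal
difference operators `∑ aₙ(s) exp(n ∂ₛ)` in which `n` is bounded above.  The entry `(i, j)` lies on
the `(j - i)`-th diagonal. -/
structure BandMatrix where
  /-- the entries, row index first -/
  entry : ℤ → ℤ → ℝ
  bounded' : ∃ C : ℕ, ∀ i j : ℤ, i + C < j → entry i j = 0

namespace BandMatrix

instance : CoeFun BandMatrix (fun _ => ℤ → ℤ → ℝ) := ⟨entry⟩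

theorem entry_injective : Function.Injective entry := by
  rintro ⟨a, ha⟩ ⟨b, hb⟩ h
  cases h
  rfl

@[ext] theorem ext {A B : BandMatrix} (h : ∀ i j, A i j = B i j) : A = B :=
  entry_injective (funext fun i => funext fun j => h i j)

instance : Zero BandMatrix := ⟨⟨0, 0, fun _ _ _ => rfl⟩⟩

instance : Add BandMatrix := ⟨fun A B => ⟨A.entry + B.entry, by
  obtain ⟨a, ha⟩ := A.bounded'
  obtain ⟨b, hb⟩ := B.bounded'
  refine ⟨a + b, fun i j h => ?_⟩
  push_cast at h
  simp [ha i j (by omega), hb i j (by omega)]⟩⟩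

instance : Neg BandMatrix := ⟨fun A => ⟨-A.entry, by
  obtain ⟨a, ha⟩ := A.bounded'
  exact ⟨a, fun i j h => by simp [ha i j h]⟩⟩⟩

instance : Sub BandMatrix := ⟨fun A B => ⟨A.entry - B.entry, by
  obtain ⟨a, ha⟩ := A.bounded'
  obtain ⟨b, hb⟩ := B.bounded'
  refine ⟨a + b, fun i j h => ?_⟩
  push_cast at h
  simp [ha i j (by omega), hb i j (by omega)]⟩⟩

instance {S : Type*} [SMulZeroClass S ℝ] : SMul S BandMatrix := ⟨fun c A => ⟨c • A.entry, by
  obtain ⟨a, ha⟩ := A.bounded'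
  exact ⟨a, fun i j h => by simp [ha i j h]⟩⟩⟩

instance : AddCommGroup BandMatrix :=
  Function.Injective.addCommGroup entry entry_injective rfl (fun _ _ => rfl) (fun _ => rfl)
    (fun _ _ => rfl) (fun _ _ => rfl) (fun _ _ => rfl)

/-- The entries, as an additive homomorphism. -/
def entryHom : BandMatrix →+ (ℤ → ℤ → ℝ) := ⟨⟨entry, rfl⟩, fun _ _ => rfl⟩

instance : Module ℝ BandMatrix :=
  Function.Injective.module ℝ entryHom entry_injective (fun _ _ => rfl)

@[simp] theorem zero_apply (i j : ℤ) : (0 : BandMatrix) i j = 0 := rfl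
@[simp] theorem add_apply (A B : BandMatrix) (i j : ℤ) : (A + B) i j = A i j + B i j := rfl
@[simp] theorem neg_apply (A : BandMatrix) (i j : ℤ) : (-A) i j = -A i j := rfl
@[simp] theorem sub_apply (A B : BandMatrix) (i j : ℤ) : (A - B) i j = A i j - B i j := rfl
@[simp] theorem smul_apply (c : ℝ) (A : BandMatrix) (i j : ℤ) : (c • A) i j = c * A i j := rfl

theorem finsum_eq_sum {A B : BandMatrix} {a b : ℕ} (ha : ∀ i j : ℤ, i + a < j → A i j = 0)
    (hb : ∀ i j : ℤ, i + b < j → B i j = 0) {i j : ℤ} {S : Finset ℤ}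
    (hS : ∀ k, j - b ≤ k → k ≤ i + a → k ∈ S) :
    ∑ᶠ k, A i k * B k j = ∑ k ∈ S, A i k * B k j := by
  refine finsum_eq_sum_of_support_subset _ fun k hk => ?_
  by_contra hkS
  apply hk
  by_cases h1 : i + a < k
  · simp [ha i k h1]
  · have h2 : k + b < j := by
      by_contra h2
      exact hkS (by simpa using hS k (by omega) (by omega))
    simp [hb k j h2]

/-- The matrix product; all but finitely many summands vanish. -/
instance : Mul BandMatrix := ⟨fun A B => ⟨fun i j => ∑ᶠ k, A i k * B k j, by
  obtain ⟨a, ha⟩ := A.bounded'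
  obtain ⟨b, hb⟩ := B.bounded'
  refine ⟨a + b, fun i j h => ?_⟩
  push_cast at h
  rw [finsum_eq_sum ha hb (S := ∅) (fun k h1 h2 => by omega)]
  simp⟩⟩

theorem mul_def (A B : BandMatrix) (i j : ℤ) : (A * B) i j = ∑ᶠ k, A i k * B k j := rfl

theorem mul_apply {A B : BandMatrix} {a b : ℕ} (ha : ∀ i j : ℤ, i + a < j → A i j = 0)
    (hb : ∀ i j : ℤ, i + b < j → B i j = 0) {i j : ℤ} {S : Finset ℤ}
    (hS : ∀ k, j - b ≤ k → k ≤ i + a → k ∈ S) :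
    (A * B) i j = ∑ k ∈ S, A i k * B k j := finsum_eq_sum ha hb hS

/-- The matrix `diag[a(i)] Λⁿ`: its entry `(i, j)` is `a(i)` if `j = i + n`, and `0` otherwise. -/
def diagonal (a : ℤ → ℝ) (n : ℤ) : BandMatrix :=
  ⟨fun i j => if j = i + n then a i else 0, n.toNat, fun i j h => if_neg (by omega)⟩

theorem diagonal_mul (a : ℤ → ℝ) (n : ℤ) (A : BandMatrix) (i j : ℤ) :
    (diagonal a n * A) i j = a i * A (i + n) j := by
  rw [mul_def, finsum_eq_single _ (i + n)]
  · simp [diagonal]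
  · intro k hk
    simp [diagonal, hk]

theorem mul_diagonal (a : ℤ → ℝ) (n : ℤ) (A : BandMatrix) (i j : ℤ) :
    (A * diagonal a n) i j = A i (j - n) * a (j - n) := by
  rw [mul_def, finsum_eq_single _ (j - n)]
  · simp [diagonal]
  · intro k hk
    have : ¬ j = k + n := by omega
    simp [diagonal, this]

instance : One BandMatrix := ⟨diagonal 1 0⟩

theorem one_def : (1 : BandMatrix) = diagonal 1 0 := rfl

protected theorem mul_assoc (A B D : BandMatrix) : A * B * D = A * (B * D) := by
  obtain ⟨a, ha⟩ := A.bounded'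
  obtain ⟨b, hb⟩ := B.bounded'
  obtain ⟨d, hd⟩ := D.bounded'
  have hab : ∀ i j : ℤ, i + (a + b : ℕ) < j → (A * B) i j = 0 := fun i j h => by
    push_cast at h
    rw [mul_apply ha hb (S := ∅) (fun k h1 h2 => by omega)]
    simp
  have hbd : ∀ i j : ℤ, i + (b + d : ℕ) < j → (B * D) i j = 0 := fun i j h => by
    push_cast at h
    rw [mul_apply hb hd (S := ∅) (fun k h1 h2 => by omega)]
    simp
  ext i j
  set S := Finset.Icc (j - b - d) (i + a + b) with hS
  rw [mul_apply hab hd (S := S)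
      (fun k h1 h2 => by rw [hS, Finset.mem_Icc]; push_cast at h2; omega),
    mul_apply ha hbd (S := S)
      (fun k h1 h2 => by rw [hS, Finset.mem_Icc]; push_cast at h1; omega)]
  have e1 : ∀ k ∈ S, (A * B) i k * D k j = ∑ l ∈ S, A i l * B l k * D k j := fun k _ => by
    by_cases hk : k + d < j
    · simp [hd k j hk]
    · rw [mul_apply ha hb (S := S)
        (fun l h1 h2 => by rw [hS, Finset.mem_Icc]; omega), Finset.sum_mul]
  have e2 : ∀ l ∈ S, A i l * (B * D) l j = ∑ k ∈ S, A i l * B l k * D k j := fun l _ => by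
    by_cases hl : i + a < l
    · simp [ha i l hl]
    · rw [mul_apply hb hd (S := S)
        (fun k h1 h2 => by rw [hS, Finset.mem_Icc]; omega), Finset.mul_sum]
      exact Finset.sum_congr rfl fun k _ => (mul_assoc _ _ _).symm
  rw [Finset.sum_congr rfl e1, Finset.sum_congr rfl e2, Finset.sum_comm]

protected theorem left_distrib (A B D : BandMatrix) : A * (B + D) = A * B + A * D := by
  obtain ⟨a, ha⟩ := A.bounded'
  obtain ⟨b, hb⟩ := B.bounded'
  obtain ⟨d, hd⟩ := D.bounded'
  have hbd : ∀ i j : ℤ, i + (b + d : ℕ) < j → (B + D) i j = 0 := fun i j h => by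
    push_cast at h
    simp [hb i j (by omega), hd i j (by omega)]
  ext i j
  set S := Finset.Icc (j - b - d) (i + a) with hS
  rw [add_apply, mul_apply ha hbd (S := S)
      (fun k h1 h2 => by rw [hS, Finset.mem_Icc]; push_cast at h1; omega),
    mul_apply ha hb (S := S) (fun k h1 h2 => by rw [hS, Finset.mem_Icc]; omega),
    mul_apply ha hd (S := S) (fun k h1 h2 => by rw [hS, Finset.mem_Icc]; omega),
    ← Finset.sum_add_distrib]
  exact Finset.sum_congr rfl fun k _ => by rw [add_apply, mul_add]

protected theorem right_distrib (A B D : BandMatrix) : (A + B) * D = A * D + B * D := by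
  obtain ⟨a, ha⟩ := A.bounded'
  obtain ⟨b, hb⟩ := B.bounded'
  obtain ⟨d, hd⟩ := D.bounded'
  have hab : ∀ i j : ℤ, i + (a + b : ℕ) < j → (A + B) i j = 0 := fun i j h => by
    push_cast at h
    simp [ha i j (by omega), hb i j (by omega)]
  ext i j
  set S := Finset.Icc (j - d) (i + a + b) with hS
  rw [add_apply, mul_apply hab hd (S := S)
      (fun k h1 h2 => by rw [hS, Finset.mem_Icc]; push_cast at h2; omega),
    mul_apply ha hd (S := S) (fun k h1 h2 => by rw [hS, Finset.mem_Icc]; omega),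
    mul_apply hb hd (S := S) (fun k h1 h2 => by rw [hS, Finset.mem_Icc]; omega),
    ← Finset.sum_add_distrib]
  exact Finset.sum_congr rfl fun k _ => by rw [add_apply, add_mul]

instance : Ring BandMatrix :=
  { (inferInstance : AddCommGroup BandMatrix) with
    mul := (· * ·)
    one := 1
    mul_assoc := BandMatrix.mul_assoc
    left_distrib := BandMatrix.left_distrib
    right_distrib := BandMatrix.right_distrib
    one_mul := fun A => by ext i j; rw [one_def, diagonal_mul]; simp
    mul_one := fun A => by ext i j; rw [one_def, mul_diagonal]; simp
    zero_mul := fun A => by ext i j; simp [mul_def]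
    mul_zero := fun A => by ext i j; simp [mul_def] }

protected theorem smul_mul (c : ℝ) (A B : BandMatrix) : c • A * B = c • (A * B) := by
  obtain ⟨a, ha⟩ := A.bounded'
  obtain ⟨b, hb⟩ := B.bounded'
  have hca : ∀ i j : ℤ, i + a < j → (c • A) i j = 0 := fun i j h => by simp [ha i j h]
  ext i j
  set S := Finset.Icc (j - b) (i + a) with hS
  rw [smul_apply, mul_apply hca hb (S := S) (fun k h1 h2 => by rw [hS, Finset.mem_Icc]; omega),
    mul_apply ha hb (S := S) (fun k h1 h2 => by rw [hS, Finset.mem_Icc]; omega), Finset.mul_sum]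
  exact Finset.sum_congr rfl fun k _ => by rw [smul_apply, mul_assoc]

protected theorem mul_smul (c : ℝ) (A B : BandMatrix) : A * c • B = c • (A * B) := by
  obtain ⟨a, ha⟩ := A.bounded'
  obtain ⟨b, hb⟩ := B.bounded'
  have hcb : ∀ i j : ℤ, i + b < j → (c • B) i j = 0 := fun i j h => by simp [hb i j h]
  ext i j
  set S := Finset.Icc (j - b) (i + a) with hS
  rw [smul_apply, mul_apply ha hcb (S := S) (fun k h1 h2 => by rw [hS, Finset.mem_Icc]; omega),
    mul_apply ha hb (S := S) (fun k h1 h2 => by rw [hS, Finset.mem_Icc]; omega), Finset.mul_sum]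
  exact Finset.sum_congr rfl fun k _ => by rw [smul_apply]; ring

instance : Algebra ℝ BandMatrix := Algebra.ofModule BandMatrix.smul_mul BandMatrix.mul_smul

/-- The shift matrix `Λ = (δ_{i, j-1})`, an invertible matrix; `Λ` represents `exp(∂ₛ)`. -/
def shift : BandMatrixˣ where
  val := diagonal 1 1
  inv := diagonal 1 (-1)
  val_inv := by
    ext i j
    rw [diagonal_mul, one_def]
    simp [diagonal]
  inv_val := by
    ext i j
    rw [diagonal_mul, one_def]
    simp [diagonal]

/-- The matrix `Δ = (i δ_{ij})`. -/
def delta : BandMatrix := diagonal (fun i => (i : ℝ)) 0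

/-- The strictly lower triangular part `(A)_{<0}`. -/
def lowerPart (A : BandMatrix) : BandMatrix :=
  ⟨fun i j => if j < i then A i j else 0, 0, fun i j h => if_neg (by push_cast at h; omega)⟩

/-- The upper triangular part `(A)_{≥0}`, diagonal included. -/
def upperPart (A : BandMatrix) : BandMatrix :=
  ⟨fun i j => if i ≤ j then A i j else 0, by
    obtain ⟨a, ha⟩ := A.bounded'
    exact ⟨a, fun i j h => by simp [ha i j h]⟩⟩

end BandMatrix

/-! ## Matrices depending on the Toda times -/

/-- Indices of the times: `Sum.inl n` stands for `tₙ` and `Sum.inr n` for `t̄ₙ`, `n = 1, 2, …`. -/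
abbrev Time := ℕ+ ⊕ ℕ+

/-- Matrices whose entries are formal power series in all the times `tₙ`, `t̄ₙ`: formal power series
with matrix coefficients, the times being central. -/
abbrev TimeMatrix := MvPowerSeries Time BandMatrix

namespace TimeMatrix

/-- The partial derivative with respect to the time `x`. -/
def timeDeriv (x : Time) (A : TimeMatrix) : TimeMatrix :=
  fun m => ((m x : ℝ) + 1) • MvPowerSeries.coeff (m + Finsupp.single x 1) A

/-- `(A)_{<0}`. -/
def lowerPart (A : TimeMatrix) : TimeMatrix := fun m => (MvPowerSeries.coeff m A).lowerPart

/-- `(A)_{≥0}`. -/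
def upperPart (A : TimeMatrix) : TimeMatrix := fun m => (MvPowerSeries.coeff m A).upperPart

/-- The time-independent matrix `Λ`. -/
def shift : TimeMatrixˣ := Units.map (MvPowerSeries.C : BandMatrix →+* TimeMatrix) BandMatrix.shift

/-- The time-independent matrix `Δ`. -/
def delta : TimeMatrix := MvPowerSeries.C BandMatrix.delta

/-- The infinite sum `∑ₓ x · a(x)` over all the times `x`. -/
def linearSeries (a : Time → BandMatrix) : TimeMatrix :=
  fun m => if m.degree = 1 then ∑ x ∈ m.support, a x else 0

theorem coeff_single_linearSeries (a : Time → BandMatrix) (x : Time) :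
    MvPowerSeries.coeff (Finsupp.single x 1) (linearSeries a) = a x := by
  simp only [MvPowerSeries.coeff_apply, linearSeries]
  rw [if_pos (by simp), Finsupp.support_single x (one_ne_zero : (1 : ℕ) ≠ 0)]
  simp

theorem coeff_linearSeries_of_ne (a : Time → BandMatrix) (m : Time →₀ ℕ) (hm : m.degree ≠ 1) :
    MvPowerSeries.coeff m (linearSeries a) = 0 := by
  simp only [MvPowerSeries.coeff_apply, linearSeries]
  rw [if_neg hm]

/-- `∑ₙ n tₙ Λⁿ`. -/
def timeSum : TimeMatrix :=
  linearSeries (Sum.elim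
    (fun n => (n : ℝ) • ((BandMatrix.shift ^ (n : ℤ) : BandMatrixˣ) : BandMatrix)) (fun _ => 0))

/-- `∑ₙ n t̄ₙ Λ⁻ⁿ`. -/
def timeSumBar : TimeMatrix :=
  linearSeries (Sum.elim (fun _ => 0)
    (fun n => (n : ℝ) • ((BandMatrix.shift ^ (-(n : ℤ)) : BandMatrixˣ) : BandMatrix)))

/-- All entries below the main diagonal vanish. -/
def IsUpper (A : TimeMatrix) : Prop :=
  ∀ m, ∀ i j : ℤ, j < i → (MvPowerSeries.coeff m A) i j = 0

/-- All entries above the main diagonal vanish and all diagonal entries are equal to the power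
series `1`, i.e. `A = 1 + ∑_{n ≥ 1} wₙ Λ⁻ⁿ`. -/
def IsUnitLower (A : TimeMatrix) : Prop :=
  ∀ m, ∀ i j : ℤ, i ≤ j →
    (MvPowerSeries.coeff m A) i j = (MvPowerSeries.coeff m (1 : TimeMatrix)) i j

end TimeMatrix

open TimeMatrix

/-! ## Solutions of the `ħ`-dependent Toda lattice hierarchy -/

/-- The Lax operator `L = W Λ W⁻¹` (and likewise `L̄ = W̄ Λ W̄⁻¹`). -/
def lax (W : TimeMatrixˣ) : TimeMatrixˣ := W * shift * W⁻¹

/-- The Orlov-Shulman operator `M = W (ħ Δ + ∑ₙ n tₙ Λⁿ) W⁻¹`. -/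
def orlov (ħ : ℝ) (W : TimeMatrixˣ) : TimeMatrix :=
  (W : TimeMatrix) * (ħ • delta + timeSum) * ((W⁻¹ : TimeMatrixˣ) : TimeMatrix)

/-- The Orlov-Shulman operator `M̄ = W̄ (ħ Δ - ∑ₙ n t̄ₙ Λ⁻ⁿ) W̄⁻¹`. -/
def orlovBar (ħ : ℝ) (W : TimeMatrixˣ) : TimeMatrix :=
  (W : TimeMatrix) * (ħ • delta - timeSumBar) * ((W⁻¹ : TimeMatrixˣ) : TimeMatrix)

/-- `(W, W̄)` is the pair of dressing operators of a solution of the Toda lattice hierarchy: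
triangular matrices, `W = 1 + ∑_{n ≥ 1} wₙ Λ⁻ⁿ` and `W̄ = ∑_{n ≥ 0} w̄ₙ Λⁿ` with `w̄₀` invertible,
that obey the flow equations of the hierarchy; the solution is the one whose operator ratio
`U(t, t̄) = W⁻¹ W̄` has the value `U` at `t = t̄ = 0`. -/
structure IsTodaSolution (ħ : ℝ) (U : BandMatrix) (W Wbar : TimeMatrixˣ) : Prop where
  lower : IsUnitLower (W : TimeMatrix)
  upper : IsUpper (Wbar : TimeMatrix)
  upper_inv : IsUpper ((Wbar⁻¹ : TimeMatrixˣ) : TimeMatrix)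
  flow : ∀ n : ℕ+, ħ • timeDeriv (Sum.inl n) (W : TimeMatrix) =
    -lowerPart ((lax W ^ (n : ℤ) : TimeMatrixˣ) : TimeMatrix) * (W : TimeMatrix)
  flow_bar : ∀ n : ℕ+, ħ • timeDeriv (Sum.inr n) (W : TimeMatrix) =
    lowerPart ((lax Wbar ^ (-(n : ℤ)) : TimeMatrixˣ) : TimeMatrix) * (W : TimeMatrix)
  bar_flow : ∀ n : ℕ+, ħ • timeDeriv (Sum.inl n) (Wbar : TimeMatrix) =
    upperPart ((lax W ^ (n : ℤ) : TimeMatrixˣ) : TimeMatrix) * (Wbar : TimeMatrix)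
  bar_flow_bar : ∀ n : ℕ+, ħ • timeDeriv (Sum.inr n) (Wbar : TimeMatrix) =
    -upperPart ((lax Wbar ^ (-(n : ℤ)) : TimeMatrixˣ) : TimeMatrix) * (Wbar : TimeMatrix)
  initial : MvPowerSeries.constantCoeff ((W⁻¹ * Wbar : TimeMatrixˣ) : TimeMatrix) = U

/-! ## The generalized Kontsevich integrals -/

/-- The integrand `μ^(-j-1) exp(ħ⁻¹ (λ^p μ - μ^(p+1)/(p+1)))`. -/
def gkIntegrand (p : ℕ) (ħ : ℝ) (j : ℤ) (lam μ : ℝ) : ℝ :=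
  μ ^ (-j - 1) * Real.exp (ħ⁻¹ * (lam ^ p * μ - μ ^ (p + 1) / (p + 1)))

/-- The normalization `c(λ) = κ λ^((p-1)/2) exp(-ħ⁻¹ p/(p+1) λ^(p+1))`. -/
def gkNorm (p : ℕ) (ħ κ lam : ℝ) : ℝ :=
  κ * lam ^ (((p : ℝ) - 1) / 2) * Real.exp (-(ħ⁻¹ * (p / (p + 1) * lam ^ (p + 1))))

/-- The function `u_j(λ)`, with path of integration `S ⊆ ℝ`. -/
def gkFunction (p : ℕ) (ħ κ : ℝ) (S : Set ℝ) (j : ℤ) (lam : ℝ) : ℝ :=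
  gkNorm p ħ κ lam * ∫ μ in S, gkIntegrand p ħ j lam μ

/-- `f(λ) ∼ ∑_{i ≥ j} a_i λ^(-i-1)` as `λ → +∞`, with `a_i = 0` for `i < j`. -/
def HasAsymptoticExpansion (f : ℝ → ℝ) (j : ℤ) (a : ℤ → ℝ) : Prop :=
  (∀ i < j, a i = 0) ∧
    ∀ N : ℕ, (fun lam => f lam - ∑ n ∈ Finset.range N, a (j + n) * lam ^ (-(j + n) - 1))
      =O[atTop] fun lam : ℝ => lam ^ (-(j + N) - 1)

/-- The integral defining `u_j` along `S` converges and `u_j(λ) ∼ ∑_{i ≥ j} λ^(-i-1) U_{ij}` as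
`λ → +∞`. -/
def HasGKExpansion (p : ℕ) (ħ κ : ℝ) (S : Set ℝ) (U : BandMatrix) (j : ℤ) : Prop :=
  (∀ lam > 0, IntegrableOn (gkIntegrand p ħ j lam) S) ∧
    HasAsymptoticExpansion (gkFunction p ħ κ S j) j (fun i => U i j)

end Toda

end

/-!
The integrals `u_j` are handled by Laplace's method in a purely algebraic form. With `μ = λ x` and
`s = λ^(p+1) / ħ` they become `∫ x^(-j-1) exp(-s φ(x)) dx`, up to an explicit factor, where the
phase `φ(x) = p/(p+1) - x + x^(p+1)/(p+1)` has the analytic square root `y = phaseRoot p` with a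
simple zero at the critical point `x = 1`. An amplitude `g` that is analytic on `x > 0` can be
written as `g = c₀(g) y' + φ' q` with `q` analytic. The first summand contributes a Gaussian
integral, and the second contributes `1/s` times the integral of `q'`, by integration by parts.
Iteration gives `∫ g exp(-s φ) ∼ √(π/s) ∑ₖ cₖ(g) s⁻ᵏ` with `cₖ₊₁(g) = cₖ(q')` (`laplaceCoeff`,
`localLaplace_expansion`). What lies outside `[1/2, 2]` is smaller than any power of `s`, so that
neither the cut-off nor the choice of the path matters (`scaledIntegral_Ioi_sub_isBigO`,
`scaledIntegral_univ_sub_isBigO`).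

The linear relations for the coefficient matrix `gkMatrix` are identities between the numbers
`cₖ(xⁿ)` and need no differentiation of asymptotic expansions. They follow from
`cₖ₊₁(φ' q) = cₖ(q')` (`laplaceCoeff_phaseDeriv_mul`), from `cₖ₊₁(φ g) = (k + 1/2) cₖ(g)`
(`laplaceCoeff_phase_mul`), which replaces the derivative in `s`, and from
`φ - x φ'/(p+1) = p/(p+1) (1 - x)`, which expresses the homogeneity of the phase.

On the Toda side, a pair of triangular `W`, `W̄` solves the hierarchy if and only if `V = W⁻¹ W̄`
obeys the linear flows `ħ ∂V/∂tₙ = Λⁿ V`, `ħ ∂V/∂t̄ₙ = -V Λ⁻ⁿ` (`IsTodaSolution.ratio_flow`,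
`isTodaSolution_of_factorization`). These have a unique solution with a given initial value
(`evolution`, `eq_zero_of_flow`). The factorization of `V` into triangular factors is unique, since
only `1` is both upper triangular and lower triangular with unit diagonal; it exists since `U` is
lower triangular with nonzero diagonal entries and the higher orders in the times can be solved for
recursively (`exists_factorization`). Finally, each string equation is equivalent to an identity
`A V = V B` between undressed operators. The flows preserve such an identity when `A` and `B` obey
the corresponding Lax equations (`intertwining_of_constantCoeff`), and at `t = t̄ = 0` it is one of the
two linear relations for `U`.
-/

noncomputable section

namespace Toda

/-! ### The phase function and the Laplace coefficients of an analytic amplitude -/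

/-- The phase `φ(x) = p/(p+1) - x + x^(p+1)/(p+1)` of the rescaled integrals; on `x ≥ 0` it has a
unique zero, the nondegenerate minimum `x = 1`. -/
def phase (p : ℕ) (x : ℝ) : ℝ := p / (p + 1) - x + x ^ (p + 1) / (p + 1)

/-- The quotient `φ(x) / (x - 1)²`, a polynomial with nonnegative coefficients. -/
def phaseQuot (p : ℕ) (x : ℝ) : ℝ := (∑ k ∈ Finset.range p, ((p : ℝ) - k) * x ^ k) / (p + 1)

/-- The quotient `φ'(x) / (x - 1) = 1 + x + ⋯ + x^(p-1)`. -/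
def phaseDerivQuot (p : ℕ) (x : ℝ) : ℝ := ∑ k ∈ Finset.range p, x ^ k

/-- The analytic square root `y` of the phase, with the sign of `x - 1` on `x > 0`. -/
def phaseRoot (p : ℕ) (x : ℝ) : ℝ := (x - 1) * Real.exp (Real.log (phaseQuot p x) / 2)

theorem phase_eq (p : ℕ) (x : ℝ) : phase p x = (x - 1) ^ 2 * phaseQuot p x := by
  have key : ∀ n : ℕ, (x - 1) ^ 2 * ∑ k ∈ Finset.range n, ((n : ℝ) - k) * x ^ k =
      x ^ (n + 1) - (n + 1) * x + n := by
    intro n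
    induction n with
    | zero => simp
    | succ n ih =>
      have h : ∑ k ∈ Finset.range (n + 1), (((n + 1 : ℕ) : ℝ) - k) * x ^ k =
          ∑ k ∈ Finset.range n, ((n : ℝ) - k) * x ^ k + ∑ k ∈ Finset.range (n + 1), x ^ k := by
        rw [Finset.sum_range_succ, Finset.sum_range_succ (fun k => x ^ k), ← add_assoc,
          ← Finset.sum_add_distrib]
        congr 1
        · exact Finset.sum_congr rfl fun k _ => by push_cast; ring
        · push_cast; ring
      have hg := mul_geom_sum x (n + 1)
      rw [h, mul_add, ih]
      push_cast
      linear_combination (x - 1) * hg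
  have hp : (p : ℝ) + 1 ≠ 0 := by positivity
  rw [phase, phaseQuot, mul_div_assoc', key]
  field_simp
  ring

theorem sub_one_mul_phaseDerivQuot (p : ℕ) (x : ℝ) : (x - 1) * phaseDerivQuot p x = x ^ p - 1 :=
  mul_geom_sum x p

theorem hasDerivAt_phase (p : ℕ) (x : ℝ) : HasDerivAt (phase p) (x ^ p - 1) x := by
  have hp : (p : ℝ) + 1 ≠ 0 := by positivity
  have h := ((hasDerivAt_const x ((p : ℝ) / (p + 1))).sub (hasDerivAt_id x)).add
    ((hasDerivAt_pow (p + 1) x).div_const ((p : ℝ) + 1))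
  refine h.congr_deriv ?_
  push_cast
  field_simp
  ring

theorem continuous_phase (p : ℕ) : Continuous (phase p) := by
  unfold phase
  fun_prop

theorem le_phaseQuot (p : ℕ) {x : ℝ} (hp : 1 ≤ p) (hx : 0 ≤ x) :
    (1 / 2 : ℝ) ≤ phaseQuot p x := by
  have hp1 : (0 : ℝ) < p + 1 := by positivity
  have hp' : (1 : ℝ) ≤ p := by exact_mod_cast hp
  rw [phaseQuot, le_div_iff₀ hp1]
  have h := Finset.single_le_sum (s := Finset.range p) (f := fun k : ℕ => ((p : ℝ) - k) * x ^ k)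
    (fun k hk => mul_nonneg (sub_nonneg.2 (by exact_mod_cast (Finset.mem_range.1 hk).le))
      (pow_nonneg hx k)) (Finset.mem_range.2 (show 0 < p by omega))
  simp only [CharP.cast_eq_zero, sub_zero, pow_zero, mul_one] at h
  linarith

theorem phase_ge (p : ℕ) {x : ℝ} (hp : 1 ≤ p) (hx : 0 ≤ x) :
    (x - 1) ^ 2 / 2 ≤ phase p x := by
  rw [phase_eq]
  nlinarith [le_phaseQuot p hp hx, sq_nonneg (x - 1)]

theorem phaseDerivQuot_pos {p : ℕ} {x : ℝ} (hp : 1 ≤ p) (hx : 0 < x) : 0 < phaseDerivQuot p x :=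
  Finset.sum_pos (fun _ _ => pow_pos hx _) ⟨0, Finset.mem_range.2 hp⟩

theorem phaseRoot_sq {p : ℕ} {x : ℝ} (hp : 1 ≤ p) (hx : 0 ≤ x) : phaseRoot p x ^ 2 = phase p x := by
  have h : 0 < phaseQuot p x := lt_of_lt_of_le (by norm_num) (le_phaseQuot p hp hx)
  rw [phaseRoot, mul_pow, ← Real.exp_nat_mul, phase_eq]
  congr 1
  push_cast
  rw [mul_div_cancel₀ _ (two_ne_zero), Real.exp_log h]

/-- Amplitudes: the functions that are analytic on the open half line `x > 0`. -/
def IsAmplitude (g : ℝ → ℝ) : Prop := AnalyticOnNhd ℝ g (Set.Ioi 0)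

namespace IsAmplitude

variable {f g : ℝ → ℝ}

theorem add (hf : IsAmplitude f) (hg : IsAmplitude g) : IsAmplitude (f + g) :=
  AnalyticOnNhd.add hf hg

theorem sub (hf : IsAmplitude f) (hg : IsAmplitude g) : IsAmplitude (f - g) :=
  AnalyticOnNhd.sub hf hg

theorem mul (hf : IsAmplitude f) (hg : IsAmplitude g) : IsAmplitude (f * g) :=
  AnalyticOnNhd.mul hf hg

theorem const_smul (c : ℝ) (hf : IsAmplitude f) : IsAmplitude (c • f) :=
  AnalyticOnNhd.const_smul hf

theorem deriv (hf : IsAmplitude f) : IsAmplitude (deriv f) := AnalyticOnNhd.deriv hf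

theorem differentiableAt (hf : IsAmplitude f) {x : ℝ} (hx : 0 < x) : DifferentiableAt ℝ f x :=
  (hf x hx).differentiableAt

theorem continuousOn (hf : IsAmplitude f) : ContinuousOn f (Set.Ioi 0) :=
  AnalyticOnNhd.continuousOn hf

theorem dslope (hf : IsAmplitude f) : IsAmplitude (dslope f 1) := by
  intro x hx
  by_cases h : x = 1
  · subst h
    obtain ⟨q, hq⟩ := hf 1 hx
    exact ⟨_, hq.has_fpower_series_dslope_fslope⟩
  · have h1 : AnalyticAt ℝ (fun z => (z - 1)⁻¹ * (f z - f 1)) x :=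
      ((analyticAt_id.sub analyticAt_const).inv (sub_ne_zero.2 h)).mul
        ((hf x hx).sub analyticAt_const)
    refine h1.congr ?_
    filter_upwards [dslope_eventuallyEq_slope_of_ne f h] with z hz
    rw [hz, slope_def_field, div_eq_inv_mul]

theorem zpow (n : ℤ) : IsAmplitude (fun x => x ^ n) := fun _ hx =>
  analyticAt_id.zpow (ne_of_gt hx)

theorem phase (p : ℕ) : IsAmplitude (phase p) := fun x _ => by
  unfold Toda.phase
  fun_prop

theorem phaseRoot {p : ℕ} (hp : 1 ≤ p) : IsAmplitude (phaseRoot p) := fun x hx => by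
  have h : 0 < phaseQuot p x := lt_of_lt_of_le (by norm_num) (le_phaseQuot p hp (le_of_lt hx))
  have h1 : AnalyticAt ℝ (phaseQuot p) x := by
    unfold phaseQuot
    fun_prop
  exact (analyticAt_id.sub analyticAt_const).mul ((h1.log h).div_const.rexp)

end IsAmplitude

theorem deriv_phaseRoot_one {p : ℕ} (hp : 1 ≤ p) : deriv (phaseRoot p) 1 ≠ 0 := by
  have h : 0 < phaseQuot p 1 := lt_of_lt_of_le (by norm_num) (le_phaseQuot p hp zero_le_one)
  have h1 : DifferentiableAt ℝ (phaseQuot p) 1 := by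
    unfold phaseQuot
    fun_prop
  have h2 : DifferentiableAt ℝ (fun x => Real.exp (Real.log (phaseQuot p x) / 2)) 1 :=
    ((h1.log h.ne').div_const 2).exp
  have h3 := ((hasDerivAt_id (1 : ℝ)).sub_const 1).mul h2.hasDerivAt
  have h4 : HasDerivAt (phaseRoot p) _ 1 := h3
  rw [h4.deriv]
  simp [Real.exp_ne_zero]

/-- `φ' = 2 y y'`. -/
theorem phaseRoot_mul_deriv {p : ℕ} (hp : 1 ≤ p) {x : ℝ} (hx : 0 < x) :
    2 * phaseRoot p x * deriv (phaseRoot p) x = x ^ p - 1 := by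
  have h1 := ((IsAmplitude.phaseRoot hp).differentiableAt hx).hasDerivAt.pow 2
  have h2 : (phaseRoot p) ^ 2 =ᶠ[nhds x] phase p := by
    filter_upwards [Ioi_mem_nhds hx] with z hz
    exact phaseRoot_sq hp (le_of_lt hz)
  have h3 := (hasDerivAt_phase p x).congr_of_eventuallyEq h2
  rw [← h1.unique h3]
  simp

/-- The leading Laplace coefficient of the amplitude `g`. -/
def laplaceLead (p : ℕ) (g : ℝ → ℝ) : ℝ := g 1 / deriv (phaseRoot p) 1

/-- The analytic quotient `(g - c₀ y') / φ'`, where `c₀` is the leading coefficient of `g`. -/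
def laplaceQuot (p : ℕ) (g : ℝ → ℝ) (x : ℝ) : ℝ :=
  dslope (g - laplaceLead p g • deriv (phaseRoot p)) 1 x / phaseDerivQuot p x

/-- The coefficients `cₖ(g)` of the expansion
`∫ g exp(-s φ) ∼ √(π/s) ∑ₖ cₖ(g) s⁻ᵏ` at the critical point `x = 1`, computed by
repeated integration by parts: `g = c₀(g) y' + φ' q` gives `cₖ₊₁(g) = cₖ(q')`. -/
def laplaceCoeff (p : ℕ) : ℕ → (ℝ → ℝ) → ℝ
  | 0, g => laplaceLead p g
  | k + 1, g => laplaceCoeff p k (deriv (laplaceQuot p g))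

section

variable {p : ℕ} {f g : ℝ → ℝ}

theorem IsAmplitude.laplaceQuot (hp : 1 ≤ p) (hg : IsAmplitude g) :
    IsAmplitude (laplaceQuot p g) := fun x hx => by
  have h1 : AnalyticAt ℝ (phaseDerivQuot p) x := by
    unfold phaseDerivQuot
    fun_prop
  exact ((hg.sub ((IsAmplitude.phaseRoot hp).deriv.const_smul _)).dslope x hx).div h1
    (phaseDerivQuot_pos hp hx).ne'

theorem laplaceQuot_spec (hp : 1 ≤ p) (g : ℝ → ℝ) {x : ℝ} (hx : 0 < x) :
    g x = laplaceLead p g * deriv (phaseRoot p) x + (x ^ p - 1) * laplaceQuot p g x := by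
  have h := sub_smul_dslope (g - laplaceLead p g • deriv (phaseRoot p)) 1 x
  have h0 : (g - laplaceLead p g • deriv (phaseRoot p)) 1 = 0 := by
    simp [laplaceLead, deriv_phaseRoot_one hp]
  rw [h0, sub_zero, smul_eq_mul] at h
  rw [← sub_one_mul_phaseDerivQuot, laplaceQuot, mul_assoc,
    mul_div_cancel₀ _ (phaseDerivQuot_pos hp hx).ne', h]
  simp

/-- By continuity, amplitudes that agree off the critical point agree. -/
theorem eqOn_of_eq_off_one (hf : IsAmplitude f) (hg : IsAmplitude g)
    (h : ∀ x > 0, x ≠ 1 → f x = g x) : Set.EqOn f g (Set.Ioi 0) := by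
  intro x hx
  by_cases h1 : x = 1
  · subst h1
    have e : f =ᶠ[nhdsWithin 1 {1}ᶜ] g := by
      filter_upwards [self_mem_nhdsWithin, nhdsWithin_le_nhds (Ioi_mem_nhds zero_lt_one)]
        with z hz hz0
      exact h z hz0 hz
    have t1 : Tendsto f (nhdsWithin 1 {1}ᶜ) (nhds (f 1)) :=
      (hf 1 hx).continuousAt.tendsto.mono_left nhdsWithin_le_nhds
    have t2 : Tendsto g (nhdsWithin 1 {1}ᶜ) (nhds (g 1)) :=
      (hg 1 hx).continuousAt.tendsto.mono_left nhdsWithin_le_nhds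
    exact tendsto_nhds_unique (t1.congr' e) t2
  · exact h x hx h1

theorem pow_sub_one_ne_zero (hp : 1 ≤ p) {x : ℝ} (hx : 0 < x) (h : x ≠ 1) : x ^ p - 1 ≠ 0 := by
  rw [← sub_one_mul_phaseDerivQuot]
  exact mul_ne_zero (sub_ne_zero.2 h) (phaseDerivQuot_pos hp hx).ne'

/-- The decomposition `g = c y' + φ' q` determines `c` and `q`. -/
theorem laplaceQuot_eqOn (hp : 1 ≤ p) {q : ℝ → ℝ} {c : ℝ} (hg : IsAmplitude g)
    (hq : IsAmplitude q)
    (h : ∀ x > 0, g x = c * deriv (phaseRoot p) x + (x ^ p - 1) * q x) :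
    laplaceLead p g = c ∧ Set.EqOn (laplaceQuot p g) q (Set.Ioi 0) := by
  have hc : laplaceLead p g = c := by
    rw [laplaceLead, h 1 zero_lt_one]
    simp [deriv_phaseRoot_one hp]
  refine ⟨hc, eqOn_of_eq_off_one (hg.laplaceQuot hp) hq fun x hx h1 => ?_⟩
  have h2 := laplaceQuot_spec hp g hx
  rw [h x hx, hc] at h2
  exact (mul_left_cancel₀ (pow_sub_one_ne_zero hp hx h1) (add_left_cancel h2)).symm

theorem deriv_eqOn (h : Set.EqOn f g (Set.Ioi 0)) : Set.EqOn (deriv f) (deriv g) (Set.Ioi 0) :=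
  fun _ hx => (h.eventuallyEq_of_mem (Ioi_mem_nhds hx)).deriv_eq

theorem laplaceCoeff_congr (hp : 1 ≤ p) (k : ℕ) (hf : IsAmplitude f) (hg : IsAmplitude g)
    (h : Set.EqOn f g (Set.Ioi 0)) : laplaceCoeff p k f = laplaceCoeff p k g := by
  induction k generalizing f g with
  | zero => simp only [laplaceCoeff, laplaceLead, h (Set.mem_Ioi.2 zero_lt_one)]
  | succ k ih =>
    refine ih (hf.laplaceQuot hp).deriv (hg.laplaceQuot hp).deriv (deriv_eqOn ?_)
    exact (laplaceQuot_eqOn hp hf (hg.laplaceQuot hp) fun x hx => by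
      rw [h hx]; exact laplaceQuot_spec hp g hx).2

theorem laplaceCoeff_zero (g : ℝ → ℝ) : laplaceCoeff p 0 g = laplaceLead p g := rfl

/-- Integration by parts: `cₖ₊₁(c y' + φ' q) = cₖ(q')`. -/
theorem laplaceCoeff_succ (hp : 1 ≤ p) (k : ℕ) {q : ℝ → ℝ} {c : ℝ} (hg : IsAmplitude g)
    (hq : IsAmplitude q)
    (h : ∀ x > 0, g x = c * deriv (phaseRoot p) x + (x ^ p - 1) * q x) :
    laplaceCoeff p (k + 1) g = laplaceCoeff p k (deriv q) :=
  laplaceCoeff_congr hp k (hg.laplaceQuot hp).deriv hq.deriv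
    (deriv_eqOn (laplaceQuot_eqOn hp hg hq h).2)

theorem laplaceCoeff_add (hp : 1 ≤ p) (k : ℕ) (hf : IsAmplitude f) (hg : IsAmplitude g) :
    laplaceCoeff p k (f + g) = laplaceCoeff p k f + laplaceCoeff p k g := by
  induction k generalizing f g with
  | zero => simp [laplaceCoeff, laplaceLead, add_div]
  | succ k ih =>
    rw [laplaceCoeff_succ hp k (hf.add hg) ((hf.laplaceQuot hp).add (hg.laplaceQuot hp))
      (c := laplaceLead p f + laplaceLead p g)]
    · rw [laplaceCoeff_congr hp k ((hf.laplaceQuot hp).add (hg.laplaceQuot hp)).deriv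
        ((hf.laplaceQuot hp).deriv.add (hg.laplaceQuot hp).deriv), ih (hf.laplaceQuot hp).deriv
        (hg.laplaceQuot hp).deriv]
      · rfl
      · intro x hx
        exact deriv_add ((hf.laplaceQuot hp).differentiableAt hx)
          ((hg.laplaceQuot hp).differentiableAt hx)
    · intro x hx
      simp only [Pi.add_apply]
      linear_combination laplaceQuot_spec hp f hx + laplaceQuot_spec hp g hx

theorem laplaceCoeff_smul (hp : 1 ≤ p) (k : ℕ) (a : ℝ) (hf : IsAmplitude f) :
    laplaceCoeff p k (a • f) = a * laplaceCoeff p k f := by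
  induction k generalizing f with
  | zero => simp [laplaceCoeff, laplaceLead, mul_div_assoc]
  | succ k ih =>
    rw [laplaceCoeff_succ hp k (hf.const_smul a) ((hf.laplaceQuot hp).const_smul a)
      (c := a * laplaceLead p f)]
    · rw [laplaceCoeff_congr hp k ((hf.laplaceQuot hp).const_smul a).deriv
        ((hf.laplaceQuot hp).deriv.const_smul a), ih (hf.laplaceQuot hp).deriv]
      · rfl
      · intro x hx
        exact deriv_const_smul a ((hf.laplaceQuot hp).differentiableAt hx)
    · intro x hx
      simp only [Pi.smul_apply, smul_eq_mul]
      linear_combination a * laplaceQuot_spec hp f hx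

theorem laplaceCoeff_zero_phaseDeriv_mul (q : ℝ → ℝ) (h : ∀ x > 0, g x = (x ^ p - 1) * q x) :
    laplaceCoeff p 0 g = 0 := by
  simp [laplaceCoeff, laplaceLead, h 1 zero_lt_one]

theorem laplaceCoeff_phaseDeriv_mul (hp : 1 ≤ p) (k : ℕ) {q : ℝ → ℝ} (hg : IsAmplitude g)
    (hq : IsAmplitude q) (h : ∀ x > 0, g x = (x ^ p - 1) * q x) :
    laplaceCoeff p (k + 1) g = laplaceCoeff p k (deriv q) :=
  laplaceCoeff_succ hp k (c := 0) hg hq fun x hx => by rw [h x hx]; ring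

theorem laplaceCoeff_deriv_phaseRoot (hp : 1 ≤ p) (k : ℕ) :
    laplaceCoeff p k (deriv (phaseRoot p)) = if k = 0 then 1 else 0 := by
  have h0 : IsAmplitude (0 : ℝ → ℝ) := fun _ _ => analyticAt_const
  have h1 : ∀ k, laplaceCoeff p k (0 : ℝ → ℝ) = 0 := fun k => by
    have := laplaceCoeff_smul hp k 0 h0
    simpa using this
  cases k with
  | zero => simp [laplaceCoeff, laplaceLead, deriv_phaseRoot_one hp]
  | succ k =>
    rw [laplaceCoeff_succ hp k (c := 1) (IsAmplitude.phaseRoot hp).deriv h0 (by simp)]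
    have : deriv (0 : ℝ → ℝ) = 0 := by ext x; simp
    rw [this, h1]
    simp

theorem laplaceCoeff_phase_mul_zero (g : ℝ → ℝ) :
    laplaceCoeff p 0 (phase p * g) = 0 := by
  simp [laplaceCoeff, laplaceLead, phase_eq]

theorem laplaceCoeff_phase_mul_succ (hp : 1 ≤ p) (k : ℕ) (hg : IsAmplitude g) :
    laplaceCoeff p (k + 1) (phase p * g) =
      laplaceLead p g / 2 * laplaceCoeff p k (deriv (phaseRoot p)) +
        (laplaceCoeff p k ((fun x => x ^ p - 1) * laplaceQuot p g) +
          laplaceCoeff p k (phase p * deriv (laplaceQuot p g))) := by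
  set q := laplaceQuot p g with hq_def
  have hq : IsAmplitude q := hg.laplaceQuot hp
  have hy := IsAmplitude.phaseRoot hp
  have hφ := IsAmplitude.phase p
  have hφ' : IsAmplitude (fun x => x ^ p - 1) := fun x _ => by fun_prop
  -- `φ g = φ' r` for `r = c₀ y / 2 + φ q`, as `φ = y²` and `φ' = 2 y y'`.
  have hr := (hy.const_smul (laplaceLead p g / 2)).add (hφ.mul hq)
  rw [laplaceCoeff_phaseDeriv_mul hp k (hφ.mul hg) hr, ← laplaceCoeff_smul hp k _ hy.deriv,
    ← laplaceCoeff_add hp k (hφ'.mul hq) (hφ.mul hq.deriv),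
    ← laplaceCoeff_add hp k (hy.deriv.const_smul _) ((hφ'.mul hq).add (hφ.mul hq.deriv))]
  · refine laplaceCoeff_congr hp k hr.deriv
      ((hy.deriv.const_smul _).add ((hφ'.mul hq).add (hφ.mul hq.deriv))) fun x hx => ?_
    have h1 := (((hy.differentiableAt hx).hasDerivAt.const_smul (laplaceLead p g / 2))).add
      ((hasDerivAt_phase p x).mul (hq.differentiableAt hx).hasDerivAt)
    exact h1.deriv
  · intro x hx
    have h1 := laplaceQuot_spec hp g hx
    have h2 := phaseRoot_mul_deriv hp hx
    have h3 := phaseRoot_sq hp (le_of_lt hx)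
    simp only [Pi.mul_apply, Pi.add_apply, Pi.smul_apply, smul_eq_mul]
    rw [← hq_def] at h1
    rw [h1, ← h3, ← h2]
    ring

/-- `cₖ₊₁(φ g) = (k + 1/2) cₖ(g)`: the algebraic form of differentiation in the large parameter. -/
theorem laplaceCoeff_phase_mul (hp : 1 ≤ p) (k : ℕ) (hg : IsAmplitude g) :
    laplaceCoeff p (k + 1) (phase p * g) = (k + 1 / 2) * laplaceCoeff p k g := by
  have hφ' : IsAmplitude (fun x => x ^ p - 1) := fun x _ => by fun_prop
  induction k generalizing g with
  | zero =>
    rw [laplaceCoeff_phase_mul_succ hp 0 hg, laplaceCoeff_deriv_phaseRoot hp,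
      laplaceCoeff_zero_phaseDeriv_mul (p := p) (g := (fun x => x ^ p - 1) * laplaceQuot p g)
        (laplaceQuot p g) (fun _ _ => rfl),
      laplaceCoeff_phase_mul_zero, laplaceCoeff_zero]
    simp
    ring
  | succ k ih =>
    have hq := hg.laplaceQuot hp
    rw [laplaceCoeff_phase_mul_succ hp (k + 1) hg, laplaceCoeff_deriv_phaseRoot hp,
      laplaceCoeff_phaseDeriv_mul hp k (hφ'.mul hq) hq (fun _ _ => rfl), ih hq.deriv,
      if_neg (Nat.succ_ne_zero k)]
    simp only [laplaceCoeff]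
    push_cast
    ring

end

/-! ### The matrix of asymptotic coefficients -/

section

variable {p : ℕ}

/-- The Laplace coefficient `cₖ(xⁿ)` of a power. -/
def powerCoeff (p k : ℕ) (n : ℤ) : ℝ := laplaceCoeff p k (fun x => x ^ n)

theorem powerCoeff_zero (n : ℤ) : powerCoeff p 0 n = 1 / deriv (phaseRoot p) 1 := by
  simp [powerCoeff, laplaceCoeff, laplaceLead]

theorem laplaceCoeff_deriv_zpow (hp : 1 ≤ p) (k : ℕ) (n : ℤ) :
    laplaceCoeff p k (deriv fun x : ℝ => x ^ n) = n * powerCoeff p k (n - 1) := by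
  rw [powerCoeff, ← laplaceCoeff_smul hp k _ (IsAmplitude.zpow _)]
  refine laplaceCoeff_congr hp k (IsAmplitude.zpow n).deriv
    ((IsAmplitude.zpow _).const_smul _) fun x hx => ?_
  simp [deriv_zpow]

theorem isAmplitude_phaseDeriv_mul_zpow (n : ℤ) :
    IsAmplitude ((fun x => x ^ p - 1) * fun x => x ^ n) :=
  IsAmplitude.mul (fun x _ => by fun_prop) (IsAmplitude.zpow n)

theorem powerCoeff_add_exponent (hp : 1 ≤ p) (k : ℕ) (n : ℤ) :
    powerCoeff p (k + 1) (n + p) = powerCoeff p (k + 1) n + n * powerCoeff p k (n - 1) := by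
  rw [← laplaceCoeff_deriv_zpow hp, powerCoeff, powerCoeff,
    ← laplaceCoeff_phaseDeriv_mul hp k (isAmplitude_phaseDeriv_mul_zpow n) (IsAmplitude.zpow n)
      (fun _ _ => rfl), ← laplaceCoeff_add hp _ (IsAmplitude.zpow n)
      (isAmplitude_phaseDeriv_mul_zpow n)]
  refine laplaceCoeff_congr hp _ (IsAmplitude.zpow _)
    ((IsAmplitude.zpow n).add (isAmplitude_phaseDeriv_mul_zpow n)) fun x hx => ?_
  simp only [Pi.add_apply, Pi.mul_apply]
  rw [zpow_add₀ (ne_of_gt hx), zpow_natCast]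
  ring

/-- Integration by parts combined with the scaling `φ - x φ'/(p+1) = p/(p+1) (1 - x)`. -/
theorem powerCoeff_sub_succ (hp : 1 ≤ p) (k : ℕ) (n : ℤ) :
    p * (powerCoeff p (k + 1) n - powerCoeff p (k + 1) (n + 1)) =
      ((p + 1) * (k + 1 / 2) - (n + 1)) * powerCoeff p k n := by
  have hp1 : (p : ℝ) + 1 ≠ 0 := by positivity
  have hz := IsAmplitude.zpow
  have h1 := laplaceCoeff_phase_mul hp k (hz n)
  have h2 := laplaceCoeff_phaseDeriv_mul hp k (isAmplitude_phaseDeriv_mul_zpow (n + 1))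
    (hz (n + 1)) (fun _ _ => rfl)
  rw [laplaceCoeff_deriv_zpow hp, add_sub_cancel_right] at h2
  have h3 : laplaceCoeff p (k + 1) (phase p * fun x => x ^ n) =
      (p / (p + 1)) * (powerCoeff p (k + 1) n + (-1) * powerCoeff p (k + 1) (n + 1)) +
        (1 / (p + 1)) * (((n + 1 : ℤ) : ℝ) * powerCoeff p k n) := by
    rw [← h2, powerCoeff, powerCoeff, ← laplaceCoeff_smul hp _ (-1) (hz (n + 1)),
      ← laplaceCoeff_add hp _ (hz n) ((hz (n + 1)).const_smul _),
      ← laplaceCoeff_smul hp _ _ ((hz n).add ((hz (n + 1)).const_smul _)),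
      ← laplaceCoeff_smul hp _ _ (isAmplitude_phaseDeriv_mul_zpow (n + 1)),
      ← laplaceCoeff_add hp _ (((hz n).add ((hz (n + 1)).const_smul _)).const_smul _)
        ((isAmplitude_phaseDeriv_mul_zpow (n + 1)).const_smul _)]
    refine laplaceCoeff_congr hp _ ((IsAmplitude.phase p).mul (hz n))
      ((((hz n).add ((hz (n + 1)).const_smul _)).const_smul _).add
        ((isAmplitude_phaseDeriv_mul_zpow (n + 1)).const_smul _)) fun x hx => ?_
    simp only [Pi.add_apply, Pi.mul_apply, Pi.smul_apply, smul_eq_mul, phase]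
    rw [zpow_add₀ (ne_of_gt hx), zpow_one]
    field_simp
    ring
  rw [h1] at h3
  change (k + 1 / 2) * powerCoeff p k n = _ at h3
  push_cast at h3
  field_simp at h3 ⊢
  linear_combination -h3

/-- The matrix of the coefficients of `u_j`: only the entries with `i - j = (p+1) k`, `k ≥ 0`, are
nonzero, and they are Laplace coefficients of powers. -/
def gkMatrix (p : ℕ) (ħ κ : ℝ) : BandMatrix :=
  ⟨fun i j => if 0 ≤ i - j ∧ ((p : ℤ) + 1) ∣ i - j then
      κ * Real.sqrt (Real.pi * ħ) * ħ ^ ((i - j) / ((p : ℤ) + 1)).toNat *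
        powerCoeff p ((i - j) / ((p : ℤ) + 1)).toNat (-j - 1)
    else 0, 0, fun i j h => if_neg (by push_cast at h; omega)⟩

variable {ħ κ : ℝ}

theorem gkMatrix_apply (k : ℕ) {i j : ℤ} (h : i - j = (p + 1) * k) :
    gkMatrix p ħ κ i j =
      κ * Real.sqrt (Real.pi * ħ) * ħ ^ k * powerCoeff p k (-j - 1) := by
  have h1 : ((i - j) / ((p : ℤ) + 1)).toNat = k := by
    rw [h, Int.mul_ediv_cancel_left _ (by positivity)]
    simp
  have h2 : 0 ≤ i - j ∧ ((p : ℤ) + 1) ∣ i - j := ⟨by rw [h]; positivity, ⟨k, h⟩⟩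
  simp only [gkMatrix, h1, if_pos h2]

theorem gkMatrix_eq_zero {i j : ℤ} (h : ∀ k : ℕ, i - j ≠ (p + 1) * k) :
    gkMatrix p ħ κ i j = 0 := by
  refine if_neg fun h1 => ?_
  obtain ⟨h0, d, hd⟩ := h1
  have hd0 : 0 ≤ d := by
    by_contra hneg
    have : ((p : ℤ) + 1) * d < 0 := mul_neg_of_pos_of_neg (by positivity) (by omega)
    omega
  obtain ⟨k, rfl⟩ := Int.eq_ofNat_of_zero_le hd0
  exact h k hd

theorem gkMatrix_diag_ne_zero (hp : 1 ≤ p) (hħ : 0 < ħ) (hκ : κ ≠ 0) (j : ℤ) :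
    gkMatrix p ħ κ j j ≠ 0 := by
  rw [gkMatrix_apply 0 (by simp), powerCoeff_zero]
  have : Real.sqrt (Real.pi * ħ) ≠ 0 := (Real.sqrt_pos.2 (mul_pos Real.pi_pos hħ)).ne'
  have := deriv_phaseRoot_one hp
  simp [*]

theorem gkMatrix_lower {i j : ℤ} (h : i < j) : gkMatrix p ħ κ i j = 0 := by
  refine gkMatrix_eq_zero fun k hk => ?_
  have : (0 : ℤ) ≤ (p + 1) * k := by positivity
  omega

theorem gkMatrix_shift_left (hp : 1 ≤ p) (i j : ℤ) :
    gkMatrix p ħ κ (i + p) j =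
      ħ * (j + 1) * gkMatrix p ħ κ i (j + 1) + gkMatrix p ħ κ i (j - p) := by
  by_cases h : ∃ k : ℕ, i + p - j = (p + 1) * k
  · obtain ⟨k, hk⟩ := h
    rw [gkMatrix_apply k hk, gkMatrix_apply (i := i) (j := j - p) k (by linarith)]
    cases k with
    | zero =>
      rw [gkMatrix_eq_zero (i := i) (j := j + 1), powerCoeff_zero, powerCoeff_zero]
      · ring
      · intro k hk'
        have : (0 : ℤ) ≤ (p + 1) * k := by positivity
        push_cast at hk
        omega
    | succ k =>
      rw [gkMatrix_apply (i := i) (j := j + 1) k (by push_cast at hk; linarith)]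
      have h1 := powerCoeff_add_exponent hp k (-j - 1)
      rw [show -(j - p) - 1 = -j - 1 + (p : ℤ) by ring, h1,
        show -(j + 1) - 1 = -j - 1 - 1 by ring]
      push_cast
      ring
  · push Not at h
    rw [gkMatrix_eq_zero h, gkMatrix_eq_zero (i := i) (j := j + 1),
      gkMatrix_eq_zero (i := i) (j := j - p)]
    · ring
    · intro k hk
      exact h k (by linarith)
    · intro k hk
      exact h (k + 1) (by push_cast; linarith)

theorem gkMatrix_shift_right (hp : 1 ≤ p) (i j : ℤ) :
    gkMatrix p ħ κ i (j - 1) =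
      (-(ħ / p) * i + ħ * ((p - 1) / (2 * p))) * gkMatrix p ħ κ (i - p) j +
        gkMatrix p ħ κ (i + 1) j := by
  have hp0 : (p : ℝ) ≠ 0 := by positivity
  by_cases h : ∃ k : ℕ, i - (j - 1) = (p + 1) * k
  · obtain ⟨k, hk⟩ := h
    rw [gkMatrix_apply k hk, gkMatrix_apply (i := i + 1) (j := j) k (by linarith)]
    cases k with
    | zero =>
      rw [gkMatrix_eq_zero (i := i - p) (j := j), powerCoeff_zero, powerCoeff_zero]
      · ring
      · intro k hk'
        have : (0 : ℤ) ≤ (p + 1) * k := by positivity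
        push_cast at hk
        omega
    | succ k =>
      rw [gkMatrix_apply (i := i - p) (j := j) k (by push_cast at hk; linarith)]
      have h1 := powerCoeff_sub_succ hp k (-j - 1)
      have hi : (i : ℝ) = j - 1 + (p + 1) * (k + 1) := by
        have : i = j - 1 + (p + 1) * (k + 1) := by push_cast at hk; linarith
        exact_mod_cast this
      rw [show -(j - 1) - 1 = -j - 1 + 1 by ring, hi]
      push_cast at h1 ⊢
      field_simp
      linear_combination (-2 * ħ * κ * Real.sqrt (Real.pi * ħ) * ħ ^ k) * h1
  · push Not at h
    rw [gkMatrix_eq_zero h, gkMatrix_eq_zero (i := i - p) (j := j),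
      gkMatrix_eq_zero (i := i + 1) (j := j)]
    · ring
    · intro k hk
      exact h k (by linarith)
    · intro k hk
      exact h (k + 1) (by push_cast; linarith)

end

theorem BandMatrix.val_shift_zpow (n : ℤ) :
    ((BandMatrix.shift ^ n : BandMatrixˣ) : BandMatrix) = BandMatrix.diagonal 1 n := by
  have hadd : ∀ a b : ℤ, BandMatrix.diagonal 1 a * BandMatrix.diagonal 1 b =
      BandMatrix.diagonal 1 (a + b) := fun a b => by
    ext i j
    rw [BandMatrix.diagonal_mul]
    simp [BandMatrix.diagonal, add_assoc]
  induction n with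
  | zero => rfl
  | succ n ih => rw [zpow_add_one, Units.val_mul, ih, ← hadd]; rfl
  | pred n ih => rw [zpow_sub_one, Units.val_mul, ih, sub_eq_add_neg, ← hadd]; rfl

theorem BandMatrix.val_shift : (BandMatrix.shift : BandMatrix) = BandMatrix.diagonal 1 1 := rfl

theorem BandMatrix.val_shift_inv :
    ((BandMatrix.shift⁻¹ : BandMatrixˣ) : BandMatrix) = BandMatrix.diagonal 1 (-1) := rfl

theorem BandMatrix.val_shift_pow (n : ℕ) :
    ((BandMatrix.shift ^ n : BandMatrixˣ) : BandMatrix) = BandMatrix.diagonal 1 n := by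
  rw [← zpow_natCast, BandMatrix.val_shift_zpow]

section

variable {p : ℕ} (ħ κ : ℝ)

open BandMatrix in
theorem shift_pow_mul_gkMatrix (hp : 1 ≤ p) :
    ((BandMatrix.shift ^ p : BandMatrixˣ) : BandMatrix) * gkMatrix p ħ κ =
      gkMatrix p ħ κ * (ħ • (BandMatrix.delta * ((BandMatrix.shift⁻¹ : BandMatrixˣ) : BandMatrix)) +
          ((BandMatrix.shift ^ p : BandMatrixˣ) : BandMatrix)) := by
  ext i j
  rw [val_shift_pow, val_shift_inv, mul_add, mul_smul_comm, ← mul_assoc, add_apply, smul_apply,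
    diagonal_mul, mul_diagonal, mul_diagonal, delta, mul_diagonal]
  have := gkMatrix_shift_left (ħ := ħ) (κ := κ) hp i j
  simp only [Pi.one_apply, one_mul, mul_one, sub_neg_eq_add, sub_zero]
  rw [this]
  push_cast
  ring

open BandMatrix in
theorem gkMatrix_mul_shift (hp : 1 ≤ p) :
    gkMatrix p ħ κ * (BandMatrix.shift : BandMatrix) =
        (-(ħ / p) • (BandMatrix.delta *
            ((BandMatrix.shift ^ (-(p : ℤ)) : BandMatrixˣ) : BandMatrix)) +
          (ħ * ((p - 1) / (2 * p))) •
            ((BandMatrix.shift ^ (-(p : ℤ)) : BandMatrixˣ) : BandMatrix) +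
          (BandMatrix.shift : BandMatrix)) * gkMatrix p ħ κ := by
  ext i j
  rw [val_shift_zpow, val_shift, add_mul, add_mul, smul_mul_assoc, smul_mul_assoc, mul_assoc,
    add_apply, add_apply, smul_apply, smul_apply, delta, diagonal_mul, diagonal_mul, diagonal_mul,
    diagonal_mul, mul_diagonal]
  simp only [Pi.one_apply, one_mul, mul_one, add_zero]
  rw [gkMatrix_shift_right (ħ := ħ) (κ := κ) hp i j, ← sub_eq_add_neg i (p : ℤ)]
  ring

end

/-! ### Laplace's method near the critical point -/

/-- An exponential integral with phase at least `δ` is `O(exp(-δ s))`. -/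
theorem laplaceIntegral_isBigO_exp {S : Set ℝ} {f g : ℝ → ℝ} {δ s₀ : ℝ} (hS : MeasurableSet S)
    (hf : ∀ x ∈ S, δ ≤ f x) (hint : IntegrableOn (fun x => g x * Real.exp (-(s₀ * f x))) S) :
    (fun s => ∫ x in S, g x * Real.exp (-(s * f x))) =O[atTop] fun s => Real.exp (-(δ * s)) := by
  refine IsBigO.of_bound ((∫ x in S, |g x * Real.exp (-(s₀ * f x))|) * Real.exp (s₀ * δ)) ?_
  filter_upwards [eventually_ge_atTop s₀] with s hs
  have h1 : ∀ᵐ x ∂(volume.restrict S), ‖g x * Real.exp (-(s * f x))‖ ≤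
      |g x * Real.exp (-(s₀ * f x))| * (Real.exp (s₀ * δ) * Real.exp (-(δ * s))) := by
    filter_upwards [ae_restrict_mem hS] with x hx
    rw [Real.norm_eq_abs, abs_mul, abs_mul, mul_assoc, Real.abs_exp, Real.abs_exp, ← Real.exp_add,
      ← Real.exp_add]
    refine mul_le_mul_of_nonneg_left (Real.exp_le_exp.2 ?_) (abs_nonneg _)
    nlinarith [mul_le_mul_of_nonneg_left (hf x hx) (sub_nonneg.2 hs)]
  have h2 := norm_integral_le_of_norm_le (hint.abs.mul_const _) h1
  rw [integral_mul_const] at h2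
  rwa [Real.norm_eq_abs (Real.exp _), Real.abs_exp, mul_assoc]

theorem exp_neg_mul_isBigO_inv_pow {δ : ℝ} (hδ : 0 < δ) (N : ℕ) :
    (fun s : ℝ => Real.exp (-(δ * s))) =O[atTop] fun s => (s ^ N)⁻¹ := by
  have h := (isLittleO_exp_neg_mul_rpow_atTop hδ (-(N : ℝ))).isBigO
  refine (h.congr' (Eventually.of_forall fun s => by simp only [neg_mul]) ?_)
  filter_upwards [eventually_gt_atTop 0] with s hs
  rw [Real.rpow_neg hs.le, Real.rpow_natCast]

/-- The contribution of the interval `[1/2, 2]` to the Laplace integral of the amplitude `g`. -/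
def localLaplace (p : ℕ) (g : ℝ → ℝ) (s : ℝ) : ℝ :=
  ∫ x in (1 / 2 : ℝ)..2, g x * Real.exp (-(s * phase p x))

section

variable {p : ℕ} {f g : ℝ → ℝ}

theorem uIcc_subset_Ioi : Set.uIcc (1 / 2 : ℝ) 2 ⊆ Set.Ioi 0 := by
  rw [Set.uIcc_of_le (by norm_num)]
  intro x hx
  exact lt_of_lt_of_le (by norm_num) hx.1

theorem IsAmplitude.intervalIntegrable (hg : IsAmplitude g) (s : ℝ) :
    IntervalIntegrable (fun x => g x * Real.exp (-(s * Toda.phase p x))) volume (1 / 2) 2 :=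
  ((hg.continuousOn.mono uIcc_subset_Ioi).mul
    (((continuous_phase p).const_mul s).neg.rexp.continuousOn)).intervalIntegrable

theorem localLaplace_isBigO_one (hp : 1 ≤ p) (hg : IsAmplitude g) :
    localLaplace p g =O[atTop] fun _ => (1 : ℝ) := by
  obtain ⟨C, hC⟩ := isCompact_uIcc.exists_bound_of_continuousOn
    (hg.continuousOn.mono uIcc_subset_Ioi)
  refine IsBigO.of_bound (C * |2 - 1 / 2|) ?_
  filter_upwards [eventually_ge_atTop 0] with s hs
  rw [norm_one, mul_one]
  refine intervalIntegral.norm_integral_le_of_norm_le_const fun x hx => ?_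
  have hx' := Set.uIoc_subset_uIcc hx
  have h0 : 0 ≤ phase p x :=
    le_trans (by positivity) (phase_ge p hp (le_of_lt (uIcc_subset_Ioi hx')))
  rw [norm_mul, Real.norm_eq_abs (Real.exp _), Real.abs_exp]
  refine (mul_le_of_le_one_right (norm_nonneg _) ?_).trans (hC x hx')
  rw [Real.exp_le_one_iff]
  nlinarith [mul_nonneg hs h0]

theorem localLaplace_by_parts (hg : IsAmplitude g) (s : ℝ) :
    localLaplace p (deriv g) s - s * localLaplace p ((fun x => x ^ p - 1) * g) s =
      g 2 * Real.exp (-(s * phase p 2)) - g (1 / 2) * Real.exp (-(s * phase p (1 / 2))) := by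
  have hφ' : IsAmplitude (fun x => x ^ p - 1) := fun x _ => by fun_prop
  have i1 := hg.deriv.intervalIntegrable (p := p) s
  have i2 := ((hφ'.mul hg).intervalIntegrable (p := p) s).const_mul s
  rw [localLaplace, localLaplace, ← intervalIntegral.integral_const_mul,
    ← intervalIntegral.integral_sub i1 i2]
  refine intervalIntegral.integral_eq_sub_of_hasDerivAt
    (f := fun x => g x * Real.exp (-(s * phase p x))) (fun x hx => ?_) (i1.sub i2)
  have h1 := (hg.differentiableAt (uIcc_subset_Ioi hx)).hasDerivAt.mul
    ((hasDerivAt_phase p x).const_mul s).neg.exp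
  refine h1.congr_deriv ?_
  simp only [Pi.mul_apply, Pi.neg_apply]
  ring

theorem localLaplace_deriv_phaseRoot (hp : 1 ≤ p) (s : ℝ) :
    localLaplace p (deriv (phaseRoot p)) s =
      ∫ v in phaseRoot p (1 / 2)..phaseRoot p 2, Real.exp (-s * v ^ 2) := by
  have hy := IsAmplitude.phaseRoot hp
  rw [← intervalIntegral.integral_comp_mul_deriv (f := phaseRoot p) (f' := deriv (phaseRoot p))
    (g := fun v => Real.exp (-s * v ^ 2))]
  · refine intervalIntegral.integral_congr fun x hx => ?_
    simp only [Function.comp, phaseRoot_sq hp (le_of_lt (uIcc_subset_Ioi hx))]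
    rw [mul_comm, neg_mul]
  · exact fun x hx => (hy.differentiableAt (uIcc_subset_Ioi hx)).hasDerivAt
  · exact hy.deriv.continuousOn.mono uIcc_subset_Ioi
  · fun_prop

/-- For the amplitude `y'` the Laplace integral is a Gaussian integral, up to exponentially small
terms. -/
theorem localLaplace_deriv_phaseRoot_sub_isBigO (hp : 1 ≤ p) (N : ℕ) :
    (fun s => localLaplace p (deriv (phaseRoot p)) s - Real.sqrt (Real.pi / s)) =O[atTop]
      fun s => (s ^ N)⁻¹ := by
  set a := phaseRoot p (1 / 2) with ha
  set b := phaseRoot p 2 with hb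
  have ha0 : a < 0 := mul_neg_of_neg_of_pos (by norm_num) (Real.exp_pos _)
  have hb0 : 0 < b := mul_pos (by norm_num) (Real.exp_pos _)
  have hint : ∀ s : ℝ, 0 < s → Integrable (fun v : ℝ => Real.exp (-s * v ^ 2)) :=
    fun s hs => integrable_exp_neg_mul_sq hs
  have e : ∀ {S : Set ℝ}, IntegrableOn (fun x : ℝ => (1 : ℝ) * Real.exp (-(1 * x ^ 2))) S :=
    fun {S} => by simpa using (hint 1 one_pos).integrableOn (s := S)
  have t1 := laplaceIntegral_isBigO_exp (S := Set.Iic a) (δ := a ^ 2) (g := fun _ => 1)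
    (f := fun v => v ^ 2) (s₀ := 1) measurableSet_Iic
    (fun x hx => by nlinarith [Set.mem_Iic.1 hx]) e
  have t2 := laplaceIntegral_isBigO_exp (S := Set.Ioi b) (δ := b ^ 2) (g := fun _ => 1)
    (f := fun v => v ^ 2) (s₀ := 1) measurableSet_Ioi
    (fun x hx => by nlinarith [Set.mem_Ioi.1 hx]) e
  have t3 := ((t1.trans (exp_neg_mul_isBigO_inv_pow (sq_pos_of_neg ha0) N)).add
    (t2.trans (exp_neg_mul_isBigO_inv_pow (by positivity) N))).neg_left
  refine t3.congr' ?_ EventuallyEq.rfl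
  filter_upwards [eventually_gt_atTop 0] with s hs
  rw [localLaplace_deriv_phaseRoot hp, ← ha, ← hb, ← integral_gaussian,
    ← intervalIntegral.integral_Iic_add_Ioi (b := b) (hint s hs).integrableOn
      (hint s hs).integrableOn,
    ← intervalIntegral.integral_Iic_sub_Iic (hint s hs).integrableOn (hint s hs).integrableOn]
  simp only [one_mul, neg_mul]
  ring

/-- Laplace's method for the interval `[1/2, 2]`: integration by parts moves the decomposition
`g = c₀ y' + φ' q` to `q'`, at the cost of a factor `1/s`. -/
theorem localLaplace_expansion (hp : 1 ≤ p) (K : ℕ) (hg : IsAmplitude g) :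
    (fun s => localLaplace p g s -
      ∑ k ∈ Finset.range K, laplaceCoeff p k g * (s ^ k)⁻¹ * Real.sqrt (Real.pi / s)) =O[atTop]
        fun s => (s ^ K)⁻¹ := by
  induction K generalizing g with
  | zero => simpa using localLaplace_isBigO_one hp hg
  | succ K ih =>
    have hq := hg.laplaceQuot hp
    set q := laplaceQuot p g with hq_def
    have hφ' : IsAmplitude (fun x => x ^ p - 1) := fun x _ => by fun_prop
    have hsplit : ∀ s, localLaplace p g s =
        laplaceLead p g * localLaplace p (deriv (phaseRoot p)) s +
          localLaplace p ((fun x => x ^ p - 1) * q) s := fun s => by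
      rw [localLaplace, localLaplace, localLaplace, ← intervalIntegral.integral_const_mul,
        ← intervalIntegral.integral_add
          (((IsAmplitude.phaseRoot hp).deriv.intervalIntegrable s).const_mul _)
          ((hφ'.mul hq).intervalIntegrable s)]
      refine intervalIntegral.integral_congr fun x hx => ?_
      simp only [Pi.mul_apply]
      rw [laplaceQuot_spec hp g (uIcc_subset_Ioi hx)]
      ring
    have hphase : ∀ x : ℝ, 0 ≤ x → x ≠ 1 → 0 < phase p x := fun x hx h1 =>
      lt_of_lt_of_le (by have := sub_ne_zero.2 h1; positivity) (phase_ge p hp hx)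
    have hb : ∀ x : ℝ, 0 ≤ x → x ≠ 1 → (fun s : ℝ => q x * Real.exp (-(s * phase p x))) =O[atTop]
        fun s => (s ^ K)⁻¹ := fun x hx h1 => by
      simp_rw [mul_comm _ (phase p x)]
      exact (exp_neg_mul_isBigO_inv_pow (hphase x hx h1) K).const_mul_left _
    have h1 := (localLaplace_deriv_phaseRoot_sub_isBigO hp (K + 1)).const_mul_left (laplaceLead p g)
    have h2 := ((ih hq.deriv).sub
      ((hb 2 (by norm_num) (by norm_num)).sub (hb (1 / 2) (by norm_num) (by norm_num))))
    have h3 := (isBigO_refl (fun s : ℝ => s⁻¹) atTop).mul h2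
    have h4 : (fun s : ℝ => s⁻¹ * (s ^ K)⁻¹) = fun s => (s ^ (K + 1))⁻¹ := by
      ext s
      rw [pow_succ', mul_inv]
    rw [h4] at h3
    refine (h1.add h3).congr' ?_ EventuallyEq.rfl
    filter_upwards [eventually_gt_atTop 0] with s hs
    have h5 := localLaplace_by_parts (p := p) hq s
    rw [hsplit, ← h5, Finset.sum_range_succ']
    have h6 : ∑ k ∈ Finset.range K,
        laplaceCoeff p (k + 1) g * (s ^ (k + 1))⁻¹ * Real.sqrt (Real.pi / s) =
        s⁻¹ * ∑ k ∈ Finset.range K,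
          laplaceCoeff p k (deriv q) * (s ^ k)⁻¹ * Real.sqrt (Real.pi / s) := by
      rw [Finset.mul_sum]
      refine Finset.sum_congr rfl fun k _ => ?_
      rw [laplaceCoeff, pow_succ', mul_inv]
      ring
    rw [h6, laplaceCoeff_zero]
    field_simp
    ring

end

/-! ### Convergence and rescaling of the generalized Kontsevich integrals -/

section

variable {p : ℕ} {ħ : ℝ}

theorem gkIntegrand_isBigO_exp (hp : 1 ≤ p) (hħ : 0 < ħ) (j : ℤ) (lam : ℝ) :
    gkIntegrand p ħ j lam =O[atTop] fun μ => Real.exp (-1 * μ) := by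
  set N := (-j - 1).natAbs
  have h1 : (fun μ : ℝ => μ ^ N) =O[atTop] Real.exp :=
    (Real.isLittleO_pow_exp_atTop (n := N)).isBigO
  have h2 : (fun μ : ℝ => μ ^ (-j - 1)) =O[atTop] fun μ => μ ^ N := by
    refine IsBigO.of_bound 1 ?_
    filter_upwards [eventually_ge_atTop 1] with μ hμ
    have h0 : 0 < μ := by linarith
    rw [one_mul, Real.norm_of_nonneg (zpow_nonneg h0.le _), Real.norm_of_nonneg (by positivity),
      ← zpow_natCast]
    exact zpow_le_zpow_right₀ hμ Int.le_natAbs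
  have h3 : (fun μ : ℝ => Real.exp (ħ⁻¹ * (lam ^ p * μ - μ ^ (p + 1) / (p + 1)))) =O[atTop]
      fun μ => Real.exp (-2 * μ) := by
    refine IsBigO.of_bound 1 ?_
    filter_upwards [eventually_ge_atTop 0,
      (tendsto_pow_atTop (by omega : p ≠ 0)).eventually_ge_atTop
        ((p + 1) * (lam ^ p + 2 * ħ))] with μ h0 hμ
    rw [one_mul, Real.norm_eq_abs, Real.norm_eq_abs, Real.abs_exp, Real.abs_exp, Real.exp_le_exp,
      inv_mul_le_iff₀ hħ]
    have hp1 : (0 : ℝ) < p + 1 := by positivity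
    have h4 : (lam ^ p + 2 * ħ) * μ ≤ μ ^ (p + 1) / (p + 1) := by
      rw [le_div_iff₀ hp1, pow_succ]
      nlinarith [mul_le_mul_of_nonneg_right hμ h0]
    linarith
  refine ((h2.trans h1).mul h3).congr (fun _ => rfl) fun μ => ?_
  rw [← Real.exp_add]
  ring_nf

theorem integrableOn_gkIntegrand_Ioi (hp : 1 ≤ p) (hħ : 0 < ħ) (j : ℤ) (lam : ℝ) {ε : ℝ}
    (hε : 0 < ε) : IntegrableOn (gkIntegrand p ħ j lam) (Set.Ioi ε) := by
  refine integrable_of_isBigO_exp_neg one_pos ?_ (gkIntegrand_isBigO_exp hp hħ j lam)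
  refine ContinuousOn.mul (continuousOn_id.zpow₀ _ fun x hx => Or.inl ?_) (by fun_prop)
  exact (lt_of_lt_of_le hε hx).ne'

theorem integrable_gkIntegrand (hp : Odd p) (hħ : 0 < ħ) {j : ℤ} (hj : j < 0) {lam : ℝ}
    (hlam : 0 ≤ lam) : Integrable (gkIntegrand p ħ j lam) := by
  have hc : Continuous (gkIntegrand p ħ j lam) :=
    (continuous_id.zpow₀ _ fun _ => Or.inr (by omega)).mul (by fun_prop)
  have h1 := gkIntegrand_isBigO_exp hp.pos hħ j lam
  -- For odd `p` reflection of `μ > 0` decreases the absolute value of the integrand.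
  have h2 : (fun μ => gkIntegrand p ħ j lam (-μ)) =O[atTop] gkIntegrand p ħ j lam := by
    refine IsBigO.of_bound 1 ?_
    filter_upwards [eventually_ge_atTop 0] with μ hμ
    rw [one_mul, gkIntegrand, gkIntegrand, norm_mul, norm_mul, norm_zpow, norm_zpow, norm_neg,
      hp.add_one.neg_pow]
    simp only [Real.norm_eq_abs, Real.abs_exp]
    refine mul_le_mul_of_nonneg_left (Real.exp_le_exp.2 ?_) (zpow_nonneg (abs_nonneg _) _)
    refine mul_le_mul_of_nonneg_left ?_ (inv_nonneg.2 hħ.le)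
    nlinarith [mul_nonneg (pow_nonneg hlam p) hμ]
  have h3 := (h2.trans h1).comp_tendsto tendsto_neg_atBot_atTop
  simp only [Function.comp_def, neg_neg, neg_mul, one_mul] at h3
  refine hc.locallyIntegrable.integrable_of_isBigO_atBot_atTop h3 ⟨Set.Iic 0, Iic_mem_atBot 0,
    integrableOn_exp_Iic 0⟩ h1 ⟨Set.Ioi 0, Ioi_mem_atTop 0, ?_⟩
  exact exp_neg_integrableOn_Ioi 0 one_pos

/-- In the variable `x = μ / λ`, the integrand is `x^(-j-1) exp(-s φ(x))` with `s = λ^(p+1) / ħ`, up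
to a factor. -/
theorem gkIntegrand_mul {lam : ℝ} (j : ℤ) (x : ℝ) :
    gkIntegrand p ħ j lam (lam * x) = lam ^ (-j - 1) *
      Real.exp (ħ⁻¹ * (p / (p + 1) * lam ^ (p + 1))) *
        (x ^ (-j - 1) * Real.exp (-(lam ^ (p + 1) / ħ * phase p x))) := by
  have h : ħ⁻¹ * (lam ^ p * (lam * x) - (lam * x) ^ (p + 1) / (p + 1)) =
      ħ⁻¹ * (p / (p + 1) * lam ^ (p + 1)) + -(lam ^ (p + 1) / ħ * phase p x) := by
    rw [phase, mul_pow]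
    ring
  rw [gkIntegrand, mul_zpow, h, Real.exp_add]
  ring

theorem integrableOn_scaled {S : Set ℝ} {s : ℝ} {j : ℤ}
    (h : IntegrableOn (gkIntegrand p s⁻¹ j 1) S) :
    IntegrableOn (fun x => x ^ (-j - 1) * Real.exp (-(s * phase p x))) S := by
  have h1 := h.const_mul (Real.exp (s * (p / (p + 1))))⁻¹
  refine (integrable_congr (Eventually.of_forall fun x => ?_)).1 h1
  have h2 := gkIntegrand_mul (p := p) (ħ := s⁻¹) (lam := 1) j x
  rw [one_mul] at h2
  simp only [h2, one_zpow, one_pow, inv_inv, one_mul, mul_one, one_div]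
  rw [inv_mul_cancel_left₀ (Real.exp_ne_zero _)]

open Pointwise in
theorem gkFunction_eq {κ lam : ℝ} (hlam : 0 < lam) (j : ℤ) {S T : Set ℝ} (h : lam • T = S) :
    gkFunction p ħ κ S j lam = κ * lam ^ (((p : ℝ) - 1) / 2) * lam ^ (-j) *
      ∫ x in T, x ^ (-j - 1) * Real.exp (-(lam ^ (p + 1) / ħ * phase p x)) := by
  have h1 := Measure.setIntegral_comp_smul_of_pos volume (gkIntegrand p ħ j lam) T hlam
  simp only [smul_eq_mul, gkIntegrand_mul] at h1
  rw [integral_const_mul, h, Module.finrank_self, pow_one] at h1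
  have h2 : ∫ x in S, gkIntegrand p ħ j lam x = lam * (lam⁻¹ * ∫ x in S, gkIntegrand p ħ j lam x) :=
    by rw [mul_inv_cancel_left₀ hlam.ne']
  rw [gkFunction, h2, ← h1, gkNorm, Real.exp_neg, zpow_sub₀ hlam.ne', zpow_one]
  have := Real.exp_ne_zero (ħ⁻¹ * (p / (p + 1) * lam ^ (p + 1)))
  have := hlam.ne'
  field_simp

theorem phase_ge_of_le_half (hp : 1 ≤ p) {x : ℝ} (h0 : 0 ≤ x) (hx : x ≤ 1 / 2) :
    1 / 8 ≤ phase p x := by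
  refine le_trans ?_ (phase_ge p hp h0)
  nlinarith

theorem phase_ge_of_two_le (hp : 1 ≤ p) {x : ℝ} (hx : 2 ≤ x) : 1 / 8 ≤ phase p x := by
  refine le_trans ?_ (phase_ge p hp (by linarith))
  nlinarith

theorem phase_ge_of_odd (hp : Odd p) {x : ℝ} (hx : x ≤ 1 / 2) : 1 / 8 ≤ phase p x := by
  rcases le_total 0 x with h | h
  · exact phase_ge_of_le_half hp.pos h hx
  · have h1 : (1 : ℝ) ≤ p := by exact_mod_cast hp.pos
    have h2 : (1 / 2 : ℝ) ≤ p / (p + 1) := by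
      rw [div_le_div_iff₀ two_pos (by positivity)]
      linarith
    have h3 : 0 ≤ x ^ (p + 1) / (p + 1) := div_nonneg (hp.add_one.pow_nonneg x) (by positivity)
    rw [phase]
    linarith

/-- The integral over `x > 2` is exponentially small. -/
theorem scaledIntegral_Ioi_two_isBigO (hp : 1 ≤ p) (j : ℤ) :
    (fun s : ℝ => ∫ x in Set.Ioi (2 : ℝ), x ^ (-j - 1) * Real.exp (-(s * phase p x))) =O[atTop]
      fun s => Real.exp (-(1 / 8 * s)) :=
  laplaceIntegral_isBigO_exp (s₀ := 1) measurableSet_Ioi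
    (fun _ hx => phase_ge_of_two_le hp (le_of_lt hx))
    (integrableOn_scaled (integrableOn_gkIntegrand_Ioi hp (by norm_num) j 1 two_pos))

theorem norm_scaledIntegral_Ioc_le (hp : 1 ≤ p) (j : ℤ) {a s : ℝ} (ha : 0 < a) (ha' : a ≤ 1 / 2)
    (hs : 0 ≤ s) :
    ‖∫ x in Set.Ioc a (1 / 2), x ^ (-j - 1) * Real.exp (-(s * phase p x))‖ ≤
      (a⁻¹) ^ (-j - 1).natAbs * Real.exp (-(1 / 8 * s)) := by
  have h1 := norm_setIntegral_le_of_norm_le_const (μ := volume)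
    (f := fun x : ℝ => x ^ (-j - 1) * Real.exp (-(s * phase p x)))
    (s := Set.Ioc a (1 / 2)) (C := (a⁻¹) ^ (-j - 1).natAbs * Real.exp (-(1 / 8 * s)))
    (by simp) fun x hx => by
      have hx0 : 0 < x := ha.trans hx.1
      rw [norm_mul, Real.norm_eq_abs, Real.norm_eq_abs, Real.abs_exp,
        abs_of_nonneg (zpow_nonneg hx0.le _)]
      refine mul_le_mul ?_ (Real.exp_le_exp.2 ?_) (Real.exp_nonneg _) (by positivity)
      · calc x ^ (-j - 1) ≤ x ^ (-((-j - 1).natAbs : ℤ)) :=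
              zpow_le_zpow_right_of_le_one₀ hx0 (by linarith [hx.2]) (by omega)
          _ = (x⁻¹) ^ (-j - 1).natAbs := by rw [zpow_neg, zpow_natCast, inv_pow]
          _ ≤ (a⁻¹) ^ (-j - 1).natAbs :=
              pow_le_pow_left₀ (inv_nonneg.2 hx0.le) (inv_anti₀ ha hx.1.le) _
      · have := phase_ge_of_le_half hp hx0.le hx.2
        nlinarith
  refine h1.trans (mul_le_of_le_one_right (by positivity) ?_)
  rw [Real.volume_real_Ioc_of_le ha']
  linarith

/-- The integral over `x > ε/λ` and its part over `[1/2, 2]` agree up to any power of `s`. -/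
theorem scaledIntegral_Ioi_sub_isBigO (hp : 1 ≤ p) (hħ : 0 < ħ) (j : ℤ) {ε : ℝ} (hε : 0 < ε)
    (M : ℕ) :
    (fun lam : ℝ => (∫ x in Set.Ioi (ε / lam),
        x ^ (-j - 1) * Real.exp (-(lam ^ (p + 1) / ħ * phase p x))) -
          localLaplace p (fun x => x ^ (-j - 1)) (lam ^ (p + 1) / ħ)) =O[atTop]
      fun lam => ((lam ^ (p + 1) / ħ) ^ M)⁻¹ := by
  set N := (-j - 1).natAbs with hN
  have hs : Tendsto (fun lam : ℝ => lam ^ (p + 1) / ħ) atTop atTop :=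
    (tendsto_pow_atTop (by omega)).atTop_div_const hħ
  have t1 := ((scaledIntegral_Ioi_two_isBigO hp j).trans
    (exp_neg_mul_isBigO_inv_pow (by norm_num) M)).comp_tendsto hs
  have t2 : (fun lam : ℝ => ∫ x in Set.Ioc (ε / lam) (1 / 2),
      x ^ (-j - 1) * Real.exp (-(lam ^ (p + 1) / ħ * phase p x))) =O[atTop]
        fun lam => ((lam ^ (p + 1) / ħ) ^ M)⁻¹ := by
    have t3 : (fun lam : ℝ => ∫ x in Set.Ioc (ε / lam) (1 / 2),
        x ^ (-j - 1) * Real.exp (-(lam ^ (p + 1) / ħ * phase p x))) =O[atTop]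
          fun lam => (lam ^ (p + 1) / ħ) ^ N * Real.exp (-(1 / 8 * (lam ^ (p + 1) / ħ))) := by
      refine IsBigO.of_bound ((ε⁻¹ * ħ) ^ N) ?_
      filter_upwards [eventually_ge_atTop 1, eventually_ge_atTop (2 * ε)] with lam h1 h2
      have h0 : 0 < lam := by linarith
      refine (norm_scaledIntegral_Ioc_le hp j (by positivity)
        (by rw [div_le_div_iff₀ h0 two_pos]; linarith) (by positivity)).trans ?_
      rw [Real.norm_of_nonneg (by positivity), ← mul_assoc, ← mul_pow]
      refine mul_le_mul_of_nonneg_right (pow_le_pow_left₀ (by positivity) ?_ _) (Real.exp_nonneg _)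
      rw [inv_div, mul_assoc, mul_div_cancel₀ _ hħ.ne', div_eq_inv_mul]
      exact mul_le_mul_of_nonneg_left (le_self_pow₀ h1 (by omega)) (by positivity)
    refine t3.trans (IsBigO.comp_tendsto (k := fun lam : ℝ => lam ^ (p + 1) / ħ)
      (f := fun s => s ^ N * Real.exp (-(1 / 8 * s))) (g := fun s => (s ^ M)⁻¹) ?_ hs)
    refine ((isBigO_refl (fun s : ℝ => s ^ N) atTop).mul
      (exp_neg_mul_isBigO_inv_pow (by norm_num) (N + M))).congr' EventuallyEq.rfl ?_
    filter_upwards [eventually_gt_atTop 0] with s hs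
    rw [pow_add, mul_inv, mul_inv_cancel_left₀ (by positivity)]
  refine (t2.add t1).congr' ?_ EventuallyEq.rfl
  filter_upwards [eventually_gt_atTop 0, eventually_ge_atTop (2 * ε)] with lam h0 h2
  have ha : ε / lam ≤ 1 / 2 := by rw [div_le_div_iff₀ h0 two_pos]; linarith
  have ha0 : 0 < ε / lam := by positivity
  have hint : ∀ {b : ℝ}, 0 < b → IntegrableOn (fun x : ℝ => x ^ (-j - 1) *
      Real.exp (-(lam ^ (p + 1) / ħ * phase p x))) (Set.Ioi b) := fun hb =>
    integrableOn_scaled (integrableOn_gkIntegrand_Ioi hp (by positivity) j 1 hb)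
  rw [localLaplace, intervalIntegral.integral_of_le (by norm_num), ← Set.Ioc_union_Ioi_eq_Ioi ha,
    setIntegral_union (Set.Ioc_disjoint_Ioi le_rfl) measurableSet_Ioi
      ((hint ha0).mono_set Set.Ioc_subset_Ioi_self) (hint (by norm_num)),
    ← Set.Ioc_union_Ioi_eq_Ioi (show (1 / 2 : ℝ) ≤ 2 by norm_num),
    setIntegral_union (Set.Ioc_disjoint_Ioi le_rfl) measurableSet_Ioi
      ((hint (by norm_num)).mono_set Set.Ioc_subset_Ioi_self) (hint (by norm_num))]
  simp only [Function.comp]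
  ring

/-- For odd `p` and `j < 0` the integral over the line and its part over `[1/2, 2]` agree up to
any power of `s`. -/
theorem scaledIntegral_univ_sub_isBigO (hp : Odd p) (hħ : 0 < ħ) {j : ℤ} (hj : j < 0) (M : ℕ) :
    (fun lam : ℝ => (∫ x in Set.univ,
        x ^ (-j - 1) * Real.exp (-(lam ^ (p + 1) / ħ * phase p x))) -
          localLaplace p (fun x => x ^ (-j - 1)) (lam ^ (p + 1) / ħ)) =O[atTop]
      fun lam => ((lam ^ (p + 1) / ħ) ^ M)⁻¹ := by
  have hs : Tendsto (fun lam : ℝ => lam ^ (p + 1) / ħ) atTop atTop :=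
    (tendsto_pow_atTop (by omega)).atTop_div_const hħ
  have t1 := ((scaledIntegral_Ioi_two_isBigO hp.pos j).trans
    (exp_neg_mul_isBigO_inv_pow (by norm_num) M)).comp_tendsto hs
  have hint : ∀ {s : ℝ} {S : Set ℝ}, 0 < s → IntegrableOn (fun x : ℝ => x ^ (-j - 1) *
      Real.exp (-(s * phase p x))) S := fun {s S} h =>
    integrableOn_scaled (integrable_gkIntegrand hp (inv_pos.2 h) hj zero_le_one).integrableOn
  have t2 := ((laplaceIntegral_isBigO_exp (S := Set.Iic (1 / 2)) (f := phase p)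
    (g := fun x => x ^ (-j - 1)) (s₀ := 1) measurableSet_Iic
    (fun _ hx => phase_ge_of_odd hp hx) (hint one_pos)).trans
    (exp_neg_mul_isBigO_inv_pow (by norm_num) M)).comp_tendsto hs
  refine (t2.add t1).congr' ?_ EventuallyEq.rfl
  filter_upwards [eventually_gt_atTop 0] with lam h0
  have h1 : 0 < lam ^ (p + 1) / ħ := by positivity
  rw [localLaplace, intervalIntegral.integral_of_le (by norm_num),
    ← Set.Iic_union_Ioi (a := (1 / 2 : ℝ)),
    setIntegral_union (Set.Iic_disjoint_Ioi le_rfl) measurableSet_Ioi (hint h1) (hint h1),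
    ← Set.Ioc_union_Ioi_eq_Ioi (show (1 / 2 : ℝ) ≤ 2 by norm_num),
    setIntegral_union (Set.Ioc_disjoint_Ioi le_rfl) measurableSet_Ioi (hint h1) (hint h1)]
  simp only [Function.comp]
  ring

end

/-! ### The asymptotic expansions -/

theorem zpow_isBigO_zpow {m n : ℤ} (h : m ≤ n) :
    (fun x : ℝ => x ^ m) =O[atTop] fun x => x ^ n := by
  refine IsBigO.of_bound 1 ?_
  filter_upwards [eventually_ge_atTop 1] with x hx
  have h0 : 0 ≤ x := by linarith
  rw [one_mul, Real.norm_of_nonneg (zpow_nonneg h0 _), Real.norm_of_nonneg (zpow_nonneg h0 _)]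
  exact zpow_le_zpow_right₀ hx h

theorem HasAsymptoticExpansion.of_le {f : ℝ → ℝ} {j : ℤ} {a : ℤ → ℝ} (h0 : ∀ i < j, a i = 0)
    (h : ∀ N : ℕ, ∃ N' ≥ N,
      (fun lam => f lam - ∑ n ∈ Finset.range N', a (j + n) * lam ^ (-(j + n) - 1))
        =O[atTop] fun lam : ℝ => lam ^ (-(j + N) - 1)) : HasAsymptoticExpansion f j a := by
  refine ⟨h0, fun N => ?_⟩
  obtain ⟨N', hN, h1⟩ := h N
  have h2 : (fun lam : ℝ => ∑ n ∈ Finset.Ico N N', a (j + n) * lam ^ (-(j + n) - 1))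
      =O[atTop] fun lam : ℝ => lam ^ (-(j + N) - 1) :=
    IsBigO.fun_sum fun n hn => (zpow_isBigO_zpow
      (by have := (Finset.mem_Ico.1 hn).1; omega)).const_mul_left (a (j + n))
  refine (h1.add h2).congr (fun lam => ?_) fun _ => rfl
  rw [← Finset.sum_range_add_sum_Ico _ hN]
  ring

theorem HasAsymptoticExpansion.unique {f : ℝ → ℝ} {j : ℤ} {a b : ℤ → ℝ}
    (ha : HasAsymptoticExpansion f j a) (hb : HasAsymptoticExpansion f j b) : a = b := by
  have key : ∀ n : ℕ, a (j + n) = b (j + n) := by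
    intro n
    induction n using Nat.strong_induction_on with
    | _ n ih =>
    have h1 := (hb.2 (n + 1)).sub (ha.2 (n + 1))
    have h2 : (fun lam : ℝ => (a (j + n) - b (j + n)) * lam ^ (-(j + n) - 1))
        =O[atTop] fun lam : ℝ => lam ^ (-(j + (n + 1 : ℕ)) - 1) := by
      refine h1.congr (fun lam => ?_) fun _ => rfl
      rw [Finset.sum_range_succ, Finset.sum_range_succ,
        Finset.sum_congr rfl fun k hk => by rw [← ih k (Finset.mem_range.1 hk)]]
      ring
    have h3 := h2.mul (isBigO_refl (fun lam : ℝ => lam ^ (j + n + 1)) atTop)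
    have h4 : (fun _ : ℝ => a (j + n) - b (j + n)) =O[atTop] fun lam : ℝ => lam⁻¹ := by
      refine h3.congr' ?_ ?_
      · filter_upwards [eventually_gt_atTop 0] with lam h0
        rw [mul_assoc, ← zpow_add₀ h0.ne', show -(j + (n : ℤ)) - 1 + (j + n + 1) = 0 by ring,
          zpow_zero, mul_one]
      · filter_upwards [eventually_gt_atTop 0] with lam h0
        rw [← zpow_add₀ h0.ne', ← zpow_neg_one]
        congr 1
        push_cast
        ring
    have h5 := h4.trans_tendsto tendsto_inv_atTop_zero
    exact sub_eq_zero.1 (tendsto_nhds_unique tendsto_const_nhds h5)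
  ext i
  rcases lt_or_ge i j with h | h
  · rw [ha.1 i h, hb.1 i h]
  · obtain ⟨n, hn⟩ := Int.eq_ofNat_of_zero_le (sub_nonneg.2 h)
    have : i = j + n := by omega
    rw [this, key]

/-- A sum in which only the multiples of `d` contribute. -/
theorem sum_range_mul_eq {d : ℕ} (hd : 0 < d) (K : ℕ) (F : ℕ → ℝ)
    (hF : ∀ n, (∀ k, n ≠ d * k) → F n = 0) :
    ∑ n ∈ Finset.range (d * K), F n = ∑ k ∈ Finset.range K, F (d * k) := by
  rw [← Finset.sum_image (f := F) (g := fun k => d * k)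
    (fun a _ b _ h => Nat.eq_of_mul_eq_mul_left hd h)]
  refine (Finset.sum_subset (fun n hn => ?_) fun n hn hn' => hF n fun k hk => hn' ?_).symm
  · obtain ⟨k, hk, rfl⟩ := Finset.mem_image.1 hn
    exact Finset.mem_range.2 (Nat.mul_lt_mul_of_pos_left (Finset.mem_range.1 hk) hd)
  · subst hk
    exact Finset.mem_image.2 ⟨k, Finset.mem_range.2
      (Nat.lt_of_mul_lt_mul_left (Finset.mem_range.1 hn)), rfl⟩

section

variable {p : ℕ} {ħ κ : ℝ}

/-- The expansion of `u_j` for any path of integration `S` whose rescaled integrals agree with the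
integrals over `[1/2, 2]` up to any power of the large parameter. -/
theorem hasAsymptoticExpansion_gkFunction (hp : 1 ≤ p) (hħ : 0 < ħ) (j : ℤ) {S : Set ℝ}
    {I : ℝ → ℝ}
    (hS : ∀ lam > 0, gkFunction p ħ κ S j lam =
      κ * lam ^ (((p : ℝ) - 1) / 2) * lam ^ (-j) * I lam)
    (hI : ∀ M : ℕ, (fun lam : ℝ => I lam - localLaplace p (fun x => x ^ (-j - 1))
      (lam ^ (p + 1) / ħ)) =O[atTop] fun lam => ((lam ^ (p + 1) / ħ) ^ M)⁻¹) :
    HasAsymptoticExpansion (gkFunction p ħ κ S j) j (fun i => gkMatrix p ħ κ i j) := by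
  refine HasAsymptoticExpansion.of_le (fun i hi => gkMatrix_lower hi) fun N => ?_
  have hs : Tendsto (fun lam : ℝ => lam ^ (p + 1) / ħ) atTop atTop :=
    (tendsto_pow_atTop (by omega)).atTop_div_const hħ
  -- One term more than needed compensates for the factor `λ^((p-1)/2)` in front of the integral.
  set K := N + 1 with hK
  refine ⟨(p + 1) * K, by nlinarith, ?_⟩
  have h1 := (hI K).add
    ((localLaplace_expansion hp K (IsAmplitude.zpow (-j - 1))).comp_tendsto hs)
  have h2 : (fun lam : ℝ => lam ^ (((p : ℝ) - 1) / 2)) =O[atTop] fun lam => lam ^ p := by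
    refine IsBigO.of_bound 1 ?_
    filter_upwards [eventually_ge_atTop 1] with lam h1
    have h0 : 0 ≤ lam := by linarith
    rw [one_mul, Real.norm_of_nonneg (Real.rpow_nonneg h0 _), Real.norm_of_nonneg (by positivity),
      ← Real.rpow_natCast]
    exact Real.rpow_le_rpow_of_exponent_le h1 (by linarith [(Nat.cast_nonneg p : (0 : ℝ) ≤ p)])
  have h3 := ((h2.const_mul_left κ).mul (isBigO_refl (fun lam : ℝ => lam ^ (-j)) atTop)).mul h1
  have h4 : (fun lam : ℝ => lam ^ p * lam ^ (-j) * ((lam ^ (p + 1) / ħ) ^ K)⁻¹) =O[atTop]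
      fun lam : ℝ => lam ^ (-(j + N) - 1) := by
    have h5 : (fun lam : ℝ => ħ ^ K * lam ^ (-(j + (p + 1) * N) - 1)) =O[atTop]
        fun lam : ℝ => lam ^ (-(j + N) - 1) :=
      (zpow_isBigO_zpow (by
        nlinarith [mul_nonneg (Int.natCast_nonneg p) (Int.natCast_nonneg N)])).const_mul_left _
    refine h5.congr' ?_ EventuallyEq.rfl
    filter_upwards [eventually_gt_atTop 0] with lam h0
    rw [div_pow, inv_div, ← pow_mul, div_eq_mul_inv, ← zpow_natCast lam ((p + 1) * K), ← zpow_neg,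
      ← zpow_natCast lam p, mul_left_comm, ← zpow_add₀ h0.ne', ← zpow_add₀ h0.ne']
    congr 2
    rw [hK]
    push_cast
    ring
  refine (h3.trans h4).congr' ?_ EventuallyEq.rfl
  filter_upwards [eventually_gt_atTop 0] with lam h0
  have h6 : ∀ k : ℕ, gkMatrix p ħ κ (j + ((p + 1) * k : ℕ)) j *
      lam ^ (-(j + ((p + 1) * k : ℕ)) - 1) =
      κ * lam ^ (((p : ℝ) - 1) / 2) * lam ^ (-j) * (laplaceCoeff p k (fun x => x ^ (-j - 1)) *
        ((lam ^ (p + 1) / ħ) ^ k)⁻¹ * Real.sqrt (Real.pi / (lam ^ (p + 1) / ħ))) := fun k => by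
    have h7 : Real.sqrt (Real.pi / (lam ^ (p + 1) / ħ)) =
        Real.sqrt (Real.pi * ħ) * lam ^ (-(((p : ℝ) + 1) / 2)) := by
      rw [div_div_eq_mul_div, Real.sqrt_div (by positivity), Real.rpow_neg h0.le, div_eq_mul_inv,
        Real.sqrt_eq_rpow (lam ^ (p + 1)), ← Real.rpow_natCast, ← Real.rpow_mul h0.le]
      congr 3
      push_cast
      ring
    have h8 : lam ^ (((p : ℝ) - 1) / 2) * lam ^ (-(((p : ℝ) + 1) / 2)) = lam ^ (-1 : ℤ) := by
      rw [← Real.rpow_add h0, ← Real.rpow_intCast]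
      congr 1
      push_cast
      ring
    have h9 : lam ^ (-(j + (((p + 1) * k : ℕ) : ℤ)) - 1) =
        lam ^ (-1 : ℤ) * lam ^ (-j) * (lam ^ ((p + 1) * k))⁻¹ := by
      rw [← zpow_natCast lam ((p + 1) * k), ← zpow_neg, ← zpow_add₀ h0.ne', ← zpow_add₀ h0.ne']
      congr 1
      ring
    rw [gkMatrix_apply k (by push_cast; ring), powerCoeff, h7, h9, ← h8, div_pow, inv_div,
      ← pow_mul]
    ring
  rw [sum_range_mul_eq (Nat.succ_pos p) K
    (fun n => gkMatrix p ħ κ (j + n) j * lam ^ (-(j + n) - 1)) fun n hn => ?_,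
    Finset.sum_congr rfl fun k _ => h6 k, ← Finset.mul_sum, hS lam h0]
  · simp only [Function.comp]
    ring
  · rw [gkMatrix_eq_zero fun k hk => hn k ?_, zero_mul]
    push_cast [← @Nat.cast_inj ℤ]
    linarith

open Pointwise in
theorem hasGKExpansion_Ioi (hp : 1 ≤ p) (hħ : 0 < ħ) (κ : ℝ) {ε : ℝ} (hε : 0 < ε) (j : ℤ) :
    HasGKExpansion p ħ κ (Set.Ioi ε) (gkMatrix p ħ κ) j := by
  refine ⟨fun lam _ => integrableOn_gkIntegrand_Ioi hp hħ j lam hε,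
    hasAsymptoticExpansion_gkFunction hp hħ j
      (fun lam hlam => gkFunction_eq hlam j (T := Set.Ioi (ε / lam)) ?_)
      (scaledIntegral_Ioi_sub_isBigO hp hħ j hε)⟩
  rw [LinearOrderedField.smul_Ioi hlam, mul_div_cancel₀ _ hlam.ne']

theorem hasGKExpansion_univ (hp : Odd p) (hħ : 0 < ħ) (κ : ℝ) {j : ℤ} (hj : j < 0) :
    HasGKExpansion p ħ κ Set.univ (gkMatrix p ħ κ) j :=
  ⟨fun _ hlam => (integrable_gkIntegrand hp hħ hj (le_of_lt hlam)).integrableOn,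
    hasAsymptoticExpansion_gkFunction hp.pos hħ j
      (fun _ hlam => gkFunction_eq hlam j (Set.smul_set_univ₀ hlam.ne'))
      (scaledIntegral_univ_sub_isBigO hp hħ hj)⟩

theorem gkMatrix_unique {U V : BandMatrix} {S : Set ℝ} (hU : ∀ j, HasGKExpansion p ħ κ S U j)
    (hV : ∀ j, HasGKExpansion p ħ κ S V j) : U = V := by
  ext i j
  exact congrFun ((hU j).2.unique (hV j).2) i

end

/-! ### Triangular matrices -/

namespace BandMatrix

/-- The matrices supported on the diagonals of index `≤ d`; `d = 0` gives the lower and `d = -1`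
the strictly lower triangular matrices. -/
def below (d : ℤ) : AddSubgroup BandMatrix where
  carrier := {A | ∀ i j : ℤ, i + d < j → A i j = 0}
  add_mem' hA hB i j h := by rw [add_apply, hA i j h, hB i j h, add_zero]
  zero_mem' _ _ _ := rfl
  neg_mem' hA i j h := by rw [neg_apply, hA i j h, neg_zero]

/-- The upper triangular matrices. -/
def upper : AddSubgroup BandMatrix where
  carrier := {A | ∀ i j : ℤ, j < i → A i j = 0}
  add_mem' hA hB i j h := by rw [add_apply, hA i j h, hB i j h, add_zero]
  zero_mem' _ _ _ := rfl
  neg_mem' hA i j h := by rw [neg_apply, hA i j h, neg_zero]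

variable {A B : BandMatrix}

theorem mul_mem_below {a b d : ℤ} (hA : A ∈ below a) (hB : B ∈ below b) (hd : a + b ≤ d) :
    A * B ∈ below d := fun i j h => by
  rw [mul_def]
  refine finsum_eq_zero_of_forall_eq_zero fun k => ?_
  by_cases hk : i + a < k
  · rw [hA i k hk, zero_mul]
  · rw [hB k j (by omega), mul_zero]

theorem below_mono {a b : ℤ} (h : a ≤ b) : below a ≤ below b := fun _ hA i j hij =>
  hA i j (by omega)

theorem mul_mem_upper (hA : A ∈ upper) (hB : B ∈ upper) : A * B ∈ upper := fun i j h => by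
  rw [mul_def]
  refine finsum_eq_zero_of_forall_eq_zero fun k => ?_
  by_cases hk : k < i
  · rw [hA i k hk, zero_mul]
  · rw [hB k j (by omega), mul_zero]

theorem diagonal_mem_below (a : ℤ → ℝ) (n : ℤ) : diagonal a n ∈ below n := fun i j h =>
  if_neg (by omega)

theorem diagonal_mem_upper (a : ℤ → ℝ) : diagonal a 0 ∈ upper := fun i j h => if_neg (by omega)

theorem one_mem_below : (1 : BandMatrix) ∈ below 0 := diagonal_mem_below 1 0

theorem one_mem_upper : (1 : BandMatrix) ∈ upper := diagonal_mem_upper 1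

theorem eq_zero_of_forall_mem_below (h : ∀ K : ℕ, A ∈ below (-(K : ℤ))) : A = 0 := by
  ext i j
  exact h ((i - j).toNat + 1) i j (by push_cast; omega)

theorem eq_zero_of_mem_below_of_mem_upper (h : A ∈ below (-1)) (h' : A ∈ upper) : A = 0 := by
  ext i j
  rcases lt_or_ge j i with hij | hij
  · exact h' i j hij
  · exact h i j (by omega)

theorem pow_mem_below (hA : A ∈ below (-1)) (k : ℕ) : A ^ k ∈ below (-(k : ℤ)) := by
  induction k with
  | zero => exact one_mem_below
  | succ k ih =>
    rw [pow_succ]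
    exact mul_mem_below ih hA (by push_cast; omega)

/-- The Neumann series `∑ₖ Nᵏ`, for a strictly lower triangular matrix `N`; in the entry `(i, j)`
only the terms with `k ≤ i - j` contribute. -/
def neumann (N : BandMatrix) : BandMatrix :=
  ⟨fun i j => ∑ k ∈ Finset.range (i - j + 1).toNat, (N ^ k) i j, 0, fun i j h =>
    Finset.sum_eq_zero fun k hk => by
      rw [Finset.mem_range] at hk
      push_cast at h
      omega⟩

theorem neumann_sub_mem_below {N : BandMatrix} (hN : N ∈ below (-1)) (K : ℕ) :
    neumann N - ∑ k ∈ Finset.range K, N ^ k ∈ below (-(K : ℤ)) := fun i j h => by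
  have hs : (∑ k ∈ Finset.range K, N ^ k) i j = ∑ k ∈ Finset.range K, (N ^ k) i j := by
    change entryHom _ i j = _
    rw [map_sum, Finset.sum_apply, Finset.sum_apply]
    rfl
  rw [sub_apply, hs, sub_eq_zero]
  change ∑ k ∈ Finset.range (i - j + 1).toNat, (N ^ k) i j = _
  refine Finset.sum_subset (fun k hk => ?_) fun k hk hk' => ?_
  · rw [Finset.mem_range] at hk ⊢
    omega
  · rw [Finset.mem_range] at hk hk'
    exact pow_mem_below hN k i j (by omega)

/-- A lower triangular matrix with unit diagonal has a lower triangular inverse. -/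
theorem exists_inv_of_unitLower (hA : A - 1 ∈ below (-1)) :
    ∃ B ∈ below 0, A * B = 1 ∧ B * A = 1 := by
  have hN : 1 - A ∈ below (-1) := by
    rw [← neg_sub]
    exact neg_mem hA
  have hA0 : A ∈ below 0 := by
    have := add_mem (below_mono (by norm_num) hA) one_mem_below
    rwa [sub_add_cancel] at this
  have hB0 : neumann (1 - A) ∈ below 0 := by
    simpa using neumann_sub_mem_below hN 0
  -- With `N = 1 - A` and the partial sum `S = ∑ Nᵏ`, `k < K`, the matrix
  -- `A * neumann N - 1 = A * (neumann N - S) - N ^ K` is supported on the diagonals of index at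
  -- most `-K`, for every `K`.
  refine ⟨neumann (1 - A), hB0, sub_eq_zero.1 (eq_zero_of_forall_mem_below fun K => ?_),
    sub_eq_zero.1 (eq_zero_of_forall_mem_below fun K => ?_)⟩
  · have h1 := mul_neg_geom_sum (1 - A) K
    rw [sub_sub_cancel] at h1
    have h2 := sub_mem (mul_mem_below hA0 (neumann_sub_mem_below hN K) (zero_add _).le)
      (pow_mem_below hN K)
    rw [mul_sub, h1] at h2
    convert h2 using 1
    abel
  · have h1 := geom_sum_mul_neg (1 - A) K
    rw [sub_sub_cancel] at h1
    have h2 := sub_mem (mul_mem_below (neumann_sub_mem_below hN K) hA0 (add_zero _).le)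
      (pow_mem_below hN K)
    rw [sub_mul, h1] at h2
    convert h2 using 1
    abel

theorem lowerPart_mem (A : BandMatrix) : A.lowerPart ∈ below (-1) := fun i j h =>
  if_neg (by omega)

theorem upperPart_mem (A : BandMatrix) : A.upperPart ∈ upper := fun i j h => if_neg (by omega)

theorem upperPart_add_lowerPart (A : BandMatrix) : A.upperPart + A.lowerPart = A := by
  ext i j
  simp only [add_apply, upperPart, lowerPart]
  rcases lt_or_ge j i with h | h
  · rw [if_neg (by omega), if_pos h, zero_add]
  · rw [if_pos h, if_neg (by omega), add_zero]

/-- The splitting into an upper and a strictly lower triangular part is unique. -/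
theorem parts_eq_of_add_eq {X Y : BandMatrix} (hX : X ∈ below (-1)) (hY : Y ∈ upper)
    (h : Y + X = A) : A.upperPart = Y ∧ A.lowerPart = X := by
  have h1 : A.upperPart - Y = X - A.lowerPart := by
    rw [sub_eq_sub_iff_add_eq_add, upperPart_add_lowerPart, add_comm X, h]
  have h2 := eq_zero_of_mem_below_of_mem_upper (h1 ▸ sub_mem hX (lowerPart_mem A))
    (sub_mem (upperPart_mem A) hY)
  exact ⟨sub_eq_zero.1 h2, (sub_eq_zero.1 (h1 ▸ h2)).symm⟩

/-- A lower triangular matrix with nonzero diagonal entries is the product of a lower triangular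
matrix with unit diagonal and an invertible diagonal matrix. -/
theorem exists_unitLower_factor {U : BandMatrix} (hU : U ∈ below 0) (hd : ∀ j, U j j ≠ 0) :
    ∃ W D : BandMatrixˣ, (W : BandMatrix) - 1 ∈ below (-1) ∧ (D : BandMatrix) ∈ upper ∧
      ((D⁻¹ : BandMatrixˣ) : BandMatrix) ∈ upper ∧ (W : BandMatrix) * U = D := by
  let D : BandMatrixˣ :=
    { val := diagonal (fun i => U i i) 0
      inv := diagonal (fun i => (U i i)⁻¹) 0
      val_inv := by
        ext i j
        rw [diagonal_mul, one_def]
        simp [diagonal, hd]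
      inv_val := by
        ext i j
        rw [diagonal_mul, one_def]
        simp [diagonal, hd] }
  have hA : U * ((D⁻¹ : BandMatrixˣ) : BandMatrix) - 1 ∈ below (-1) := fun i j h => by
    change (U * diagonal (fun i => (U i i)⁻¹) 0) i j - diagonal 1 0 i j = 0
    rw [mul_diagonal, sub_zero]
    rcases eq_or_ne i j with rfl | hij
    · simp [diagonal, hd]
    · rw [hU i j (by omega)]
      simp [diagonal, hij.symm]
  obtain ⟨B, hB, h1, h2⟩ := exists_inv_of_unitLower hA
  refine ⟨⟨B, _, h2, h1⟩, D, ?_, diagonal_mem_upper _, diagonal_mem_upper _, ?_⟩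
  · have h3 := neg_mem (mul_mem_below hB hA (d := -1) (by norm_num))
    rw [mul_sub, h2, mul_one, neg_sub] at h3
    exact h3
  · change B * U = D
    rw [← mul_assoc] at h2
    rw [← Units.mul_inv_eq_one, h2]

theorem shift_zpow_mul_delta (k : ℤ) :
    ((shift ^ k : BandMatrixˣ) : BandMatrix) * delta =
      delta * ((shift ^ k : BandMatrixˣ) : BandMatrix) +
        (k : ℝ) • ((shift ^ k : BandMatrixˣ) : BandMatrix) := by
  ext i j
  rw [val_shift_zpow, diagonal_mul, add_apply, smul_apply, delta, diagonal_mul]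
  simp only [diagonal]
  by_cases h : j = i + k
  · simp [h]
  · simp [h]

end BandMatrix

/-! ### Power series in the times -/

namespace TimeMatrix

open MvPowerSeries

theorem coeff_smul (c : ℝ) (A : TimeMatrix) (m : Time →₀ ℕ) : coeff m (c • A) = c • coeff m A := rfl

theorem constantCoeff_real_smul (c : ℝ) (A : TimeMatrix) :
    constantCoeff (c • A) = c • constantCoeff A := rfl

theorem coeff_timeDeriv (x : Time) (A : TimeMatrix) (m : Time →₀ ℕ) :
    coeff m (timeDeriv x A) = ((m x : ℝ) + 1) • coeff (m + Finsupp.single x 1) A := rfl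

theorem timeDeriv_add (x : Time) (A B : TimeMatrix) :
    timeDeriv x (A + B) = timeDeriv x A + timeDeriv x B := by
  ext1 m
  simp only [coeff_timeDeriv, map_add, smul_add]

theorem timeDeriv_sub (x : Time) (A B : TimeMatrix) :
    timeDeriv x (A - B) = timeDeriv x A - timeDeriv x B := by
  ext1 m
  simp only [coeff_timeDeriv, map_sub, smul_sub]

theorem timeDeriv_smul (x : Time) (c : ℝ) (A : TimeMatrix) :
    timeDeriv x (c • A) = c • timeDeriv x A := by
  ext1 m
  simp only [coeff_timeDeriv, coeff_smul]
  rw [smul_comm]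

theorem timeDeriv_C (x : Time) (a : BandMatrix) : timeDeriv x (C a : TimeMatrix) = 0 := by
  ext1 m
  rw [coeff_timeDeriv, coeff_add_single_C, smul_zero, map_zero]

open scoped Classical in
/-- The Leibniz rule; the coefficients do not commute. -/
theorem timeDeriv_mul (x : Time) (A B : TimeMatrix) :
    timeDeriv x (A * B) = timeDeriv x A * B + A * timeDeriv x B := by
  ext1 m
  set e : Time →₀ ℕ := Finsupp.single x 1 with he
  have hex : e x = 1 := by simp [he]
  rw [map_add, coeff_timeDeriv, coeff_mul, coeff_mul, coeff_mul, Finset.smul_sum]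
  have h1 : ∀ y ∈ Finset.HasAntidiagonal.antidiagonal (m + e),
      ((m x : ℝ) + 1) • (coeff y.1 A * coeff y.2 B) =
        (y.1 x : ℝ) • (coeff y.1 A * coeff y.2 B) + (y.2 x : ℝ) • (coeff y.1 A * coeff y.2 B) := by
    intro y hy
    have h2 := DFunLike.congr_fun (Finset.HasAntidiagonal.mem_antidiagonal.1 hy) x
    rw [Finsupp.add_apply, Finsupp.add_apply, hex] at h2
    rw [← add_smul]
    congr 1
    exact_mod_cast h2.symm
  have hle : ∀ a : Time →₀ ℕ, a x ≠ 0 → a - e + e = a := fun a ha =>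
    tsub_add_cancel_of_le (Finsupp.single_le_iff.2 (Nat.one_le_iff_ne_zero.2 ha))
  rw [Finset.sum_congr rfl h1, Finset.sum_add_distrib]
  congr 1
  · symm
    refine Finset.sum_of_injOn (fun y => (y.1 + e, y.2)) ?_ ?_ ?_ ?_
    · intro a _ b _ hab
      simp only [Prod.mk.injEq, add_left_inj] at hab
      exact Prod.ext hab.1 hab.2
    · intro y hy
      rw [Finset.mem_coe, Finset.HasAntidiagonal.mem_antidiagonal] at hy ⊢
      simp only
      rw [← hy]
      abel
    · intro y hy hy'
      by_cases h0 : y.1 x = 0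
      · rw [h0, Nat.cast_zero, zero_smul]
      · refine absurd ⟨(y.1 - e, y.2), ?_, ?_⟩ hy'
        · rw [Finset.mem_coe, Finset.HasAntidiagonal.mem_antidiagonal]
          rw [Finset.HasAntidiagonal.mem_antidiagonal] at hy
          refine add_right_cancel (b := e) ?_
          rw [add_right_comm, hle _ h0, hy]
        · exact Prod.ext (hle _ h0) rfl
    · intro y _
      simp only [coeff_timeDeriv, Finsupp.add_apply, smul_mul_assoc]
      rw [hex]
      push_cast
      rfl
  · symm
    refine Finset.sum_of_injOn (fun y => (y.1, y.2 + e)) ?_ ?_ ?_ ?_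
    · intro a _ b _ hab
      simp only [Prod.mk.injEq, add_left_inj] at hab
      exact Prod.ext hab.1 hab.2
    · intro y hy
      rw [Finset.mem_coe, Finset.HasAntidiagonal.mem_antidiagonal] at hy ⊢
      simp only
      rw [← hy]
      abel
    · intro y hy hy'
      by_cases h0 : y.2 x = 0
      · rw [h0, Nat.cast_zero, zero_smul]
      · refine absurd ⟨(y.1, y.2 - e), ?_, ?_⟩ hy'
        · rw [Finset.mem_coe, Finset.HasAntidiagonal.mem_antidiagonal]
          rw [Finset.HasAntidiagonal.mem_antidiagonal] at hy
          refine add_right_cancel (b := e) ?_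
          rw [add_assoc, hle _ h0, hy]
        · exact Prod.ext rfl (hle _ h0)
    · intro y _
      simp only [coeff_timeDeriv, Finsupp.add_apply, mul_smul_comm]
      rw [hex]
      push_cast
      rfl

/-- A solution of a homogeneous linear system of flow equations with initial value `0` vanishes. -/
theorem eq_zero_of_flow {ħ : ℝ} (hħ : ħ ≠ 0) {a b : Time → BandMatrix} {F : TimeMatrix}
    (h : ∀ x, ħ • timeDeriv x F = C (a x) * F + F * C (b x)) (h0 : constantCoeff F = 0) :
    F = 0 := by
  have key : ∀ d : ℕ, ∀ m : Time →₀ ℕ, m.degree = d → coeff m F = 0 := by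
    intro d
    induction d with
    | zero =>
      intro m hm
      rw [Finsupp.degree_eq_zero_iff] at hm
      rw [hm]
      exact h0
    | succ d ih =>
      intro m hm
      obtain ⟨x, hx⟩ : ∃ x, m x ≠ 0 := by
        by_contra hne
        push Not at hne
        rw [show m = 0 from Finsupp.ext hne] at hm
        simp at hm
      have hsplit : m - Finsupp.single x 1 + Finsupp.single x 1 = m :=
        tsub_add_cancel_of_le (Finsupp.single_le_iff.2 (Nat.one_le_iff_ne_zero.2 hx))
      set m' := m - Finsupp.single x 1
      have hd : m'.degree = d := by
        have := congrArg Finsupp.degree hsplit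
        rw [map_add, Finsupp.degree_single, hm] at this
        omega
      have h1 := congrArg (coeff m') (h x)
      rw [coeff_smul, coeff_timeDeriv, hsplit, map_add, coeff_C_mul, coeff_mul_C, ih m' hd,
        mul_zero, zero_mul, add_zero] at h1
      have h2 : (m' x : ℝ) + 1 ≠ 0 := by positivity
      exact (smul_eq_zero.1 ((smul_eq_zero.1 h1).resolve_left hħ)).resolve_left h2
  ext1 m
  rw [key _ m rfl, map_zero]

/-- The power series all of whose coefficients lie in `P`. -/
def coeffsIn (P : AddSubgroup BandMatrix) : AddSubgroup TimeMatrix where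
  carrier := {A | ∀ m, coeff m A ∈ P}
  add_mem' hA hB m := by
    rw [map_add]
    exact add_mem (hA m) (hB m)
  zero_mem' m := by
    rw [map_zero]
    exact zero_mem P
  neg_mem' hA m := by
    rw [map_neg]
    exact neg_mem (hA m)

open scoped Classical in
theorem mul_mem_coeffsIn {P Q R : AddSubgroup BandMatrix} (h : ∀ a ∈ P, ∀ b ∈ Q, a * b ∈ R)
    {A B : TimeMatrix} (hA : A ∈ coeffsIn P) (hB : B ∈ coeffsIn Q) : A * B ∈ coeffsIn R :=
    fun m => by
  rw [coeff_mul]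
  exact sum_mem fun y _ => h _ (hA y.1) _ (hB y.2)

theorem C_mem_coeffsIn {P : AddSubgroup BandMatrix} {a : BandMatrix} (ha : a ∈ P) :
    (C a : TimeMatrix) ∈ coeffsIn P := fun m => by
  classical
  rw [coeff_C]
  split_ifs
  · exact ha
  · exact zero_mem P

open scoped Classical in
/-- If the coefficients of `A` lie in a set `P` that is closed under sums and products, and so does
an inverse of the constant coefficient, then the coefficients of `A⁻¹` lie in `P`. -/
theorem inv_mem_coeffsIn {P : AddSubgroup BandMatrix} (h1 : 1 ∈ P)
    (hmul : ∀ a ∈ P, ∀ b ∈ P, a * b ∈ P) {A B : TimeMatrix} (hA : A ∈ coeffsIn P) (hAB : A * B = 1)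
    {c : BandMatrix} (hc : c ∈ P) (hcA : c * constantCoeff A = 1) : B ∈ coeffsIn P := by
  set N : TimeMatrix := 1 - C c * A with hN_def
  have hN : N ∈ coeffsIn P := sub_mem (map_one (C : BandMatrix →+* TimeMatrix) ▸ C_mem_coeffsIn h1)
    (mul_mem_coeffsIn hmul (C_mem_coeffsIn hc) hA)
  have hN0 : coeff 0 N = 0 := by
    rw [coeff_zero_eq_constantCoeff_apply, hN_def, map_sub, map_mul, map_one, constantCoeff_C, hcA,
      sub_self]
  -- As `N` has no constant term, this recursion determines the coefficients of `B` by degree.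
  have hB : B = C c + N * B := by
    rw [hN_def, sub_mul, mul_assoc, hAB]
    simp
  have key : ∀ d : ℕ, ∀ m : Time →₀ ℕ, m.degree = d → coeff m B ∈ P := by
    intro d
    induction d using Nat.strong_induction_on with
    | _ d ih =>
    intro m hm
    rw [hB, map_add, coeff_mul]
    refine add_mem (C_mem_coeffsIn hc m) (sum_mem fun y hy => ?_)
    by_cases h0 : y.1 = 0
    · rw [h0, hN0, zero_mul]
      exact zero_mem P
    · refine hmul _ (hN _) _ (ih _ ?_ _ rfl)
      rw [← hm, ← Finset.HasAntidiagonal.mem_antidiagonal.1 hy, map_add]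
      have := mt (Finsupp.degree_eq_zero_iff _).1 h0
      omega
  exact fun m => key _ m rfl

/-- A map on power series that raises the order of agreement has a fixed point. -/
theorem exists_fixedPoint (Φ : TimeMatrix → TimeMatrix)
    (h : ∀ (A B : TimeMatrix) (d : ℕ), (∀ m, m.degree < d → coeff m A = coeff m B) →
      ∀ m, m.degree < d + 1 → coeff m (Φ A) = coeff m (Φ B)) : ∃ A, Φ A = A := by
  have h1 : ∀ d : ℕ, ∀ n ≥ d, ∀ m : Time →₀ ℕ, m.degree < d →
      coeff m (Φ^[n] 0) = coeff m (Φ^[d] 0) := by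
    intro d
    induction d with
    | zero => exact fun n _ m hm => absurd hm (Nat.not_lt_zero _)
    | succ d ih =>
      intro n hn
      obtain ⟨n, rfl⟩ : ∃ k, n = k + 1 := ⟨n - 1, by omega⟩
      rw [Function.iterate_succ_apply', Function.iterate_succ_apply']
      exact h _ _ d (ih n (by omega))
  let A : TimeMatrix := fun m => coeff m (Φ^[m.degree + 1] 0)
  have hA : ∀ d : ℕ, ∀ m : Time →₀ ℕ, m.degree < d → coeff m A = coeff m (Φ^[d] 0) :=
    fun d m hm => (h1 (m.degree + 1) d hm m (Nat.lt_succ_self _)).symm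
  refine ⟨A, ?_⟩
  ext1 m
  rw [h A _ m.degree (hA m.degree) m (Nat.lt_succ_self _), hA (m.degree + 1) m (Nat.lt_succ_self _),
    Function.iterate_succ_apply']

theorem upperPart_add_lowerPart (A : TimeMatrix) : upperPart A + lowerPart A = A := by
  ext1 m
  exact BandMatrix.upperPart_add_lowerPart _

theorem lowerPart_mem (A : TimeMatrix) : lowerPart A ∈ coeffsIn (BandMatrix.below (-1)) := fun _ =>
  BandMatrix.lowerPart_mem _

theorem upperPart_mem (A : TimeMatrix) : upperPart A ∈ coeffsIn BandMatrix.upper := fun _ =>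
  BandMatrix.upperPart_mem _

theorem parts_eq_of_add_eq {A X Y : TimeMatrix} (hX : X ∈ coeffsIn (BandMatrix.below (-1)))
    (hY : Y ∈ coeffsIn BandMatrix.upper) (h : Y + X = A) : upperPart A = Y ∧ lowerPart A = X :=
  ⟨by ext1 m; exact (BandMatrix.parts_eq_of_add_eq (hX m) (hY m) (congrArg (coeff m) h)).1,
    by ext1 m; exact (BandMatrix.parts_eq_of_add_eq (hX m) (hY m) (congrArg (coeff m) h)).2⟩

theorem isUnitLower_iff {A : TimeMatrix} :
    IsUnitLower A ↔ A - 1 ∈ coeffsIn (BandMatrix.below (-1)) := by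
  refine forall_congr' fun m => forall_congr' fun i => forall_congr' fun j => ?_
  rw [map_sub, BandMatrix.sub_apply, sub_eq_zero]
  exact ⟨fun h hij => h (by omega), fun h hij => h (by omega)⟩

theorem timeDeriv_mem_coeffsIn_below {d : ℤ} {A : TimeMatrix} (x : Time)
    (hA : A ∈ coeffsIn (BandMatrix.below d)) : timeDeriv x A ∈ coeffsIn (BandMatrix.below d) :=
  fun m i j h => by rw [coeff_timeDeriv, BandMatrix.smul_apply, hA _ i j h, mul_zero]

theorem timeDeriv_mem_coeffsIn_upper {A : TimeMatrix} (x : Time)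
    (hA : A ∈ coeffsIn BandMatrix.upper) : timeDeriv x A ∈ coeffsIn BandMatrix.upper :=
  fun m i j h => by rw [coeff_timeDeriv, BandMatrix.smul_apply, hA _ i j h, mul_zero]

theorem smul_mem_coeffsIn_below {d : ℤ} {A : TimeMatrix} (c : ℝ)
    (hA : A ∈ coeffsIn (BandMatrix.below d)) : c • A ∈ coeffsIn (BandMatrix.below d) :=
  fun m i j h => by rw [coeff_smul, BandMatrix.smul_apply, hA _ i j h, mul_zero]

theorem smul_mem_coeffsIn_upper {A : TimeMatrix} (c : ℝ)
    (hA : A ∈ coeffsIn BandMatrix.upper) : c • A ∈ coeffsIn BandMatrix.upper :=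
  fun m i j h => by rw [coeff_smul, BandMatrix.smul_apply, hA _ i j h, mul_zero]

/-- The inverse of a lower triangular series with unit diagonal is lower triangular. -/
theorem inv_mem_coeffsIn_below (W : TimeMatrixˣ)
    (hW : (W : TimeMatrix) - 1 ∈ coeffsIn (BandMatrix.below (-1))) :
    ((W⁻¹ : TimeMatrixˣ) : TimeMatrix) ∈ coeffsIn (BandMatrix.below 0) := by
  have h0 : constantCoeff (W : TimeMatrix) - 1 ∈ BandMatrix.below (-1) := by
    have := hW 0
    rwa [coeff_zero_eq_constantCoeff_apply, map_sub, map_one] at this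
  obtain ⟨c, hc, -, hcW⟩ := BandMatrix.exists_inv_of_unitLower h0
  refine inv_mem_coeffsIn BandMatrix.one_mem_below
    (fun a ha b hb => BandMatrix.mul_mem_below ha hb (add_zero 0).le) (A := W) ?_ W.mul_inv hc hcW
  have h1 : (1 : TimeMatrix) ∈ coeffsIn (BandMatrix.below 0) :=
    map_one (C : BandMatrix →+* TimeMatrix) ▸ C_mem_coeffsIn BandMatrix.one_mem_below
  have h2 := add_mem (s := coeffsIn (BandMatrix.below 0))
    (fun m => BandMatrix.below_mono (by norm_num) (hW m)) h1
  rwa [sub_add_cancel] at h2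

theorem constantCoeff_linearSeries (a : Time → BandMatrix) : 
    constantCoeff (linearSeries a) = 0 := by
  rw [← coeff_zero_eq_constantCoeff_apply]
  exact coeff_linearSeries_of_ne a 0 (by simp)

theorem timeDeriv_linearSeries (x : Time) (a : Time → BandMatrix) :
    timeDeriv x (linearSeries a) = C (a x) := by
  classical
  ext1 m
  rw [coeff_timeDeriv, coeff_C]
  by_cases h : m = 0
  · rw [if_pos h, h, zero_add, coeff_single_linearSeries]
    simp
  · rw [if_neg h, coeff_linearSeries_of_ne, smul_zero]
    have := mt (Finsupp.degree_eq_zero_iff m).1 h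
    rw [map_add, Finsupp.degree_single]
    omega

theorem linearSeries_commute {a : Time → BandMatrix} {b : BandMatrix} (h : ∀ x, a x * b = b * a x) :
    linearSeries a * C b = C b * linearSeries a := by
  ext1 m
  rw [coeff_mul_C, coeff_C_mul, coeff_apply, linearSeries]
  split_ifs
  · rw [Finset.sum_mul, Finset.mul_sum]
    exact Finset.sum_congr rfl fun x _ => h x
  · rw [zero_mul, mul_zero]

end TimeMatrix

/-! ### The Toda flows and the factorization problem -/

open MvPowerSeries TimeMatrix

/-- The flow equations of the operator ratio `V = W⁻¹ W̄` read `ħ ∂V/∂x = a(x) V + V b(x)`; this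
is `a`, equal to `Λⁿ` for `x = tₙ` and `0` for `x = t̄ₙ`. -/
def flowLeft : Time → BandMatrix :=
  Sum.elim (fun n => ((BandMatrix.shift ^ (n : ℤ) : BandMatrixˣ) : BandMatrix)) (fun _ => 0)

/-- The right coefficient `b` of the flow equations `ħ ∂V/∂x = a(x) V + V b(x)` of the operator
ratio, equal to `0` for `x = tₙ` and `-Λ⁻ⁿ` for `x = t̄ₙ`. -/
def flowRight : Time → BandMatrix :=
  Sum.elim (fun _ => 0) (fun n => -((BandMatrix.shift ^ (-(n : ℤ)) : BandMatrixˣ) : BandMatrix))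

/-- The operator ratio `exp(∑ tₙ Λⁿ / ħ) U exp(-∑ t̄ₙ Λ⁻ⁿ / ħ)` with the initial value `U`, given
by its coefficients. -/
def evolution (ħ : ℝ) (U : BandMatrix) : TimeMatrix := fun m =>
  (m.prod fun x k => (Sum.elim (fun _ => 1) (fun _ => -1) x / ħ) ^ k / (k.factorial : ℝ)) •
    (((BandMatrix.shift ^
          (m.sum fun x k => (k : ℤ) * Sum.elim (fun n : ℕ+ => (n : ℤ)) (fun _ => 0) x) :
        BandMatrixˣ) : BandMatrix) * U *
      ((BandMatrix.shift ^
          (m.sum fun x k => (k : ℤ) * Sum.elim (fun _ => 0) (fun n : ℕ+ => -(n : ℤ)) x) :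
        BandMatrixˣ) : BandMatrix))

theorem prod_pow_div_factorial_add_single {σ : Type*} (c : σ → ℝ) (m : σ →₀ ℕ) (x : σ) :
    ((m x : ℝ) + 1) * (m + Finsupp.single x 1).prod (fun y k => c y ^ k / (k.factorial : ℝ)) =
      c x * m.prod fun y k => c y ^ k / (k.factorial : ℝ) := by
  classical
  have h1 : (m + Finsupp.single x 1).erase x = m.erase x := by
    rw [Finsupp.erase_add, Finsupp.erase_single, add_zero]
  have h2 : ∀ m : σ →₀ ℕ, m.prod (fun y k => c y ^ k / (k.factorial : ℝ)) =
      c x ^ m x / ((m x).factorial : ℝ) *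
        (m.erase x).prod fun y k => c y ^ k / (k.factorial : ℝ) := fun m =>
    (Finsupp.mul_prod_erase' m x _ (by simp)).symm
  rw [h2, h2 m, h1, Finsupp.add_apply, Finsupp.single_eq_same, Nat.factorial_succ]
  have h3 : ((m x).factorial : ℝ) ≠ 0 := by exact_mod_cast Nat.factorial_ne_zero _
  have h4 : (m x : ℝ) + 1 ≠ 0 := by positivity
  push_cast
  field_simp
  ring

theorem sum_mul_add_single {σ : Type*} (w : σ → ℤ) (m : σ →₀ ℕ) (x : σ) :
    (m + Finsupp.single x 1).sum (fun y k => (k : ℤ) * w y) =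
      m.sum (fun y k => (k : ℤ) * w y) + w x := by
  classical
  rw [Finsupp.sum_add_index' (by simp) (by intros; push_cast; ring), Finsupp.sum_single_index] <;>
    simp

theorem constantCoeff_evolution (ħ : ℝ) (U : BandMatrix) :
    constantCoeff (evolution ħ U) = U := by
  change evolution ħ U 0 = U
  simp [evolution]

theorem evolution_flow {ħ : ℝ} (hħ : ħ ≠ 0) (U : BandMatrix) (x : Time) :
    ħ • timeDeriv x (evolution ħ U) =
      C (flowLeft x) * evolution ħ U + evolution ħ U * C (flowRight x) := by
  ext1 m
  rw [TimeMatrix.coeff_smul, coeff_timeDeriv, map_add, coeff_C_mul, coeff_mul_C]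
  simp only [coeff_apply, evolution]
  rw [smul_smul, smul_smul, mul_assoc, prod_pow_div_factorial_add_single, sum_mul_add_single,
    sum_mul_add_single, ← mul_assoc, mul_div_cancel₀ _ hħ]
  rcases x with n | n
  · simp only [flowLeft, flowRight, Sum.elim_inl, mul_zero, add_zero, one_mul]
    rw [add_comm, zpow_add, Units.val_mul, mul_smul_comm]
    simp only [mul_assoc]
  · simp only [flowLeft, flowRight, Sum.elim_inr, zero_mul, add_zero, zero_add]
    rw [zpow_add, Units.val_mul, smul_mul_assoc, neg_mul, one_mul, neg_smul, mul_neg, smul_neg]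
    simp only [mul_assoc]

theorem val_shift_zpow (n : ℤ) : ((TimeMatrix.shift ^ n : TimeMatrixˣ) : TimeMatrix) =
    C ((BandMatrix.shift ^ n : BandMatrixˣ) : BandMatrix) := by
  rw [TimeMatrix.shift, ← map_zpow]
  rfl

theorem lax_zpow (W : TimeMatrixˣ) (n : ℤ) : ((lax W ^ n : TimeMatrixˣ) : TimeMatrix) =
    (W : TimeMatrix) * C ((BandMatrix.shift ^ n : BandMatrixˣ) : BandMatrix) *
      ((W⁻¹ : TimeMatrixˣ) : TimeMatrix) := by
  rw [lax, conj_zpow, Units.val_mul, Units.val_mul, val_shift_zpow]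

section Factorization

variable {ħ : ℝ} {V : TimeMatrix} {W Wbar : TimeMatrixˣ}

/-- The derivative of a factorization `W V = W̄` of a series `V` that obeys the linear flows,
multiplied by `W̄⁻¹`. -/
theorem factorization_deriv (hV : ∀ x, ħ • timeDeriv x V = C (flowLeft x) * V + V * C (flowRight x))
    (h : (W : TimeMatrix) * V = Wbar) (x : Time) :
    ħ • timeDeriv x (Wbar : TimeMatrix) * ((Wbar⁻¹ : TimeMatrixˣ) : TimeMatrix) +
        -(ħ • timeDeriv x (W : TimeMatrix) * ((W⁻¹ : TimeMatrixˣ) : TimeMatrix)) =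
      (W : TimeMatrix) * C (flowLeft x) * ((W⁻¹ : TimeMatrixˣ) : TimeMatrix) +
        (Wbar : TimeMatrix) * C (flowRight x) * ((Wbar⁻¹ : TimeMatrixˣ) : TimeMatrix) := by
  have hV' : V = ((W⁻¹ : TimeMatrixˣ) : TimeMatrix) * Wbar := by
    rw [← h, ← mul_assoc, W.inv_mul, one_mul]
  have h1 : ħ • timeDeriv x (Wbar : TimeMatrix) =
      ħ • timeDeriv x (W : TimeMatrix) * V + W * (ħ • timeDeriv x V) := by
    rw [← h, timeDeriv_mul, smul_add, smul_mul_assoc, mul_smul_comm]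
  have h2 : V * ((Wbar⁻¹ : TimeMatrixˣ) : TimeMatrix) = ((W⁻¹ : TimeMatrixˣ) : TimeMatrix) := by
    rw [hV', mul_assoc, Wbar.mul_inv, mul_one]
  have h3 : (W : TimeMatrix) * (V * C (flowRight x)) = (Wbar : TimeMatrix) * C (flowRight x) := by
    rw [← mul_assoc, h]
  rw [h1, hV x, mul_add, h3, add_mul, add_mul, mul_assoc _ V, h2, ← mul_assoc (W : TimeMatrix),
    mul_assoc _ V, h2]
  abel

/-- The splitting of `ħ ∂W̄ W̄⁻¹ - ħ ∂W W⁻¹` into triangular parts yields the flow equations of the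
hierarchy. -/
theorem isTodaSolution_of_factorization
    (hV : ∀ x, ħ • timeDeriv x V = C (flowLeft x) * V + V * C (flowRight x))
    (h : (W : TimeMatrix) * V = Wbar)
    (hW : (W : TimeMatrix) - 1 ∈ coeffsIn (BandMatrix.below (-1)))
    (hWbar : (Wbar : TimeMatrix) ∈ coeffsIn BandMatrix.upper)
    (hWbar' : ((Wbar⁻¹ : TimeMatrixˣ) : TimeMatrix) ∈ coeffsIn BandMatrix.upper) :
    IsTodaSolution ħ (constantCoeff V) W Wbar := by
  have hX : ∀ x, -(ħ • timeDeriv x (W : TimeMatrix) * ((W⁻¹ : TimeMatrixˣ) : TimeMatrix)) ∈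
      coeffsIn (BandMatrix.below (-1)) := fun x => by
    have h1 : timeDeriv x (W : TimeMatrix) ∈ coeffsIn (BandMatrix.below (-1)) := by
      have h2 := timeDeriv_mem_coeffsIn_below x hW
      rwa [timeDeriv_sub, ← map_one (C : BandMatrix →+* TimeMatrix), timeDeriv_C, sub_zero] at h2
    exact neg_mem (mul_mem_coeffsIn (fun a ha b hb => BandMatrix.mul_mem_below ha hb (by norm_num))
      (smul_mem_coeffsIn_below ħ h1) (inv_mem_coeffsIn_below W hW))
  have hY : ∀ x, ħ • timeDeriv x (Wbar : TimeMatrix) * ((Wbar⁻¹ : TimeMatrixˣ) : TimeMatrix) ∈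
      coeffsIn BandMatrix.upper := fun x =>
    mul_mem_coeffsIn (fun a ha b hb => BandMatrix.mul_mem_upper ha hb)
      (smul_mem_coeffsIn_upper ħ (timeDeriv_mem_coeffsIn_upper x hWbar)) hWbar'
  have hp := fun x => parts_eq_of_add_eq (hX x) (hY x) (factorization_deriv hV h x)
  have hl : ∀ n : ℕ+, ((lax W ^ (n : ℤ) : TimeMatrixˣ) : TimeMatrix) =
      (W : TimeMatrix) * C (flowLeft (Sum.inl n)) * ((W⁻¹ : TimeMatrixˣ) : TimeMatrix) +
        (Wbar : TimeMatrix) * C (flowRight (Sum.inl n)) * ((Wbar⁻¹ : TimeMatrixˣ) : TimeMatrix) :=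
    fun n => by
    rw [lax_zpow]
    simp [flowLeft, flowRight]
  have hr : ∀ n : ℕ+, -((lax Wbar ^ (-(n : ℤ)) : TimeMatrixˣ) : TimeMatrix) =
      (W : TimeMatrix) * C (flowLeft (Sum.inr n)) * ((W⁻¹ : TimeMatrixˣ) : TimeMatrix) +
        (Wbar : TimeMatrix) * C (flowRight (Sum.inr n)) * ((Wbar⁻¹ : TimeMatrixˣ) : TimeMatrix) :=
    fun n => by
    rw [lax_zpow]
    simp [flowLeft, flowRight]
  have hnl : ∀ A : TimeMatrix, lowerPart (-A) = -lowerPart A := fun A =>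
    (parts_eq_of_add_eq (neg_mem (lowerPart_mem A)) (neg_mem (upperPart_mem A))
      (by rw [← neg_add, upperPart_add_lowerPart])).2
  have hnu : ∀ A : TimeMatrix, upperPart (-A) = -upperPart A := fun A =>
    (parts_eq_of_add_eq (neg_mem (lowerPart_mem A)) (neg_mem (upperPart_mem A))
      (by rw [← neg_add, upperPart_add_lowerPart])).1
  refine ⟨isUnitLower_iff.2 hW, hWbar, hWbar',
    fun n => ?_, fun n => ?_, fun n => ?_, fun n => ?_, ?_⟩
  · rw [hl, (hp _).2, neg_neg, mul_assoc, W.inv_mul, mul_one]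
  · rw [← neg_neg (lowerPart _), ← hnl, hr, (hp _).2, neg_neg, mul_assoc, W.inv_mul, mul_one]
  · rw [hl, (hp _).1, mul_assoc, Wbar.inv_mul, mul_one]
  · rw [← hnu, hr, (hp _).1, mul_assoc, Wbar.inv_mul, mul_one]
  · rw [Units.val_mul, ← h, ← mul_assoc, W.inv_mul, one_mul]

end Factorization

open scoped Classical in
/-- A series `1 + N` with `N` of positive order factorizes as `(1 + X)⁻¹ Y` with `X` strictly
lower triangular and `Y` upper triangular: `X` is the solution of `X = -(N + X N)_{<0}`. -/
theorem exists_factorization_one_add {N : TimeMatrix} (hN : constantCoeff N = 0) :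
    ∃ X ∈ coeffsIn (BandMatrix.below (-1)), constantCoeff X = 0 ∧
      (1 + X) * (1 + N) ∈ coeffsIn BandMatrix.upper := by
  have hN' : coeff 0 N = 0 := hN
  obtain ⟨X, hX⟩ := exists_fixedPoint (fun X => -lowerPart (N + X * N)) (by
    intro A B d h m hm
    have h1 : coeff m (N + A * N) = coeff m (N + B * N) := by
      rw [map_add, map_add, coeff_mul, coeff_mul]
      refine congrArg _ (Finset.sum_congr rfl fun y hy => ?_)
      by_cases h0 : y.2 = 0
      · rw [h0, hN', mul_zero, mul_zero]
      · rw [h y.1]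
        rw [← Finset.HasAntidiagonal.mem_antidiagonal.1 hy, map_add] at hm
        have := mt (Finsupp.degree_eq_zero_iff _).1 h0
        omega
    rw [map_neg, map_neg]
    exact congrArg (fun a => -BandMatrix.lowerPart a) h1)
  refine ⟨X, hX ▸ neg_mem (lowerPart_mem _), ?_, ?_⟩
  · have h1 : coeff 0 (N + X * N) = 0 := by
      rw [coeff_zero_eq_constantCoeff_apply, map_add, map_mul, hN, mul_zero, add_zero]
    rw [← hX]
    change -BandMatrix.lowerPart (coeff 0 (N + X * N)) = 0
    rw [h1, neg_eq_zero]
    ext i j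
    simp [BandMatrix.lowerPart]
  · have h1 : (1 + X) * (1 + N) = 1 + upperPart (N + X * N) := by
      have h2 := upperPart_add_lowerPart (N + X * N)
      have h3 : lowerPart (N + X * N) = -X := by rw [← hX, neg_neg, hX]
      rw [h3] at h2
      rw [← sub_eq_add_neg, sub_eq_iff_eq_add] at h2
      rw [h2]
      noncomm_ring
    rw [h1]
    exact add_mem
      (map_one (C : BandMatrix →+* TimeMatrix) ▸ C_mem_coeffsIn BandMatrix.one_mem_upper)
      (upperPart_mem _)

theorem exists_factorization {V : TimeMatrix} (hV : constantCoeff V ∈ BandMatrix.below 0)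
    (hd : ∀ j, (constantCoeff V) j j ≠ 0) :
    ∃ W Wbar : TimeMatrixˣ, (W : TimeMatrix) * V = Wbar ∧
      (W : TimeMatrix) - 1 ∈ coeffsIn (BandMatrix.below (-1)) ∧
      (Wbar : TimeMatrix) ∈ coeffsIn BandMatrix.upper ∧
      ((Wbar⁻¹ : TimeMatrixˣ) : TimeMatrix) ∈ coeffsIn BandMatrix.upper := by
  obtain ⟨W₀, D, hW₀, hD, hD', hWD⟩ := BandMatrix.exists_unitLower_factor hV hd
  set N : TimeMatrix :=
    C (W₀ : BandMatrix) * V * C ((D⁻¹ : BandMatrixˣ) : BandMatrix) - 1 with hN_def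
  have hN : constantCoeff N = 0 := by
    rw [hN_def, map_sub, map_mul, map_mul, constantCoeff_C, constantCoeff_C, map_one, hWD,
      D.mul_inv, sub_self]
  obtain ⟨X, hX, hX0, hY⟩ := exists_factorization_one_add hN
  have hXu : IsUnit (1 + X) := by
    rw [isUnit_iff_constantCoeff, map_add, map_one, hX0, add_zero]
    exact isUnit_one
  have hYu : IsUnit ((1 + X) * (1 + N)) := by
    rw [isUnit_iff_constantCoeff, map_mul, map_add, map_add, map_one, hX0, hN, add_zero, one_mul]
    exact isUnit_one
  obtain ⟨X', hX'⟩ := hXu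
  obtain ⟨Y, hYe⟩ := hYu
  have hcu : ∀ u : BandMatrixˣ, ((Units.map (C : BandMatrix →+* TimeMatrix) u : TimeMatrixˣ) :
      TimeMatrix) = C (u : BandMatrix) := fun _ => rfl
  refine ⟨X' * Units.map (C : BandMatrix →+* TimeMatrix) W₀,
    Y * Units.map (C : BandMatrix →+* TimeMatrix) D, ?_, ?_, ?_, ?_⟩
  · rw [Units.val_mul, Units.val_mul, hX', hYe, hN_def, add_sub_cancel, hcu, hcu]
    simp only [mul_assoc]
    rw [← map_mul, D.inv_mul, map_one, mul_one]
  · rw [Units.val_mul, hX', hcu]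
    have h1 : (1 + X) * C (W₀ : BandMatrix) - 1 =
        (C ((W₀ : BandMatrix) - 1) + X * C ((W₀ : BandMatrix) - 1)) + X := by
      rw [map_sub, map_one]
      noncomm_ring
    rw [h1]
    exact add_mem (add_mem (C_mem_coeffsIn hW₀) (mul_mem_coeffsIn
      (fun a ha b hb => BandMatrix.mul_mem_below ha hb (by norm_num)) hX (C_mem_coeffsIn hW₀))) hX
  · rw [Units.val_mul, hYe, hcu]
    exact mul_mem_coeffsIn (fun a ha b hb => BandMatrix.mul_mem_upper ha hb) hY (C_mem_coeffsIn hD)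
  · rw [mul_inv_rev, Units.val_mul]
    refine mul_mem_coeffsIn (fun a ha b hb => BandMatrix.mul_mem_upper ha hb)
      (C_mem_coeffsIn hD') ?_
    refine inv_mem_coeffsIn BandMatrix.one_mem_upper
      (fun a ha b hb => BandMatrix.mul_mem_upper ha hb) (A := Y) (hYe ▸ hY) Y.mul_inv
      BandMatrix.one_mem_upper ?_
    rw [hYe, map_mul, map_add, map_add, map_one, hX0, hN]
    simp

section Solution

variable {ħ : ℝ} {U : BandMatrix} {W Wbar : TimeMatrixˣ}

/-- The operator ratio `W⁻¹ W̄` of a solution of the hierarchy obeys linear flow equations. -/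
theorem IsTodaSolution.ratio_flow (h : IsTodaSolution ħ U W Wbar) (x : Time) :
    ħ • timeDeriv x ((W⁻¹ * Wbar : TimeMatrixˣ) : TimeMatrix) =
      C (flowLeft x) * ((W⁻¹ * Wbar : TimeMatrixˣ) : TimeMatrix) +
        ((W⁻¹ * Wbar : TimeMatrixˣ) : TimeMatrix) * C (flowRight x) := by
  set V : TimeMatrix := ((W⁻¹ * Wbar : TimeMatrixˣ) : TimeMatrix) with hV
  have hWV : (W : TimeMatrix) * V = Wbar := by
    rw [hV, ← Units.val_mul, mul_inv_cancel_left]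
  have h1 : (W : TimeMatrix) * (ħ • timeDeriv x V) =
      ħ • timeDeriv x (Wbar : TimeMatrix) - ħ • timeDeriv x (W : TimeMatrix) * V := by
    conv_rhs => rw [← hWV, timeDeriv_mul, smul_add, smul_mul_assoc]
    rw [add_sub_cancel_left, mul_smul_comm]
  refine W.isUnit.mul_left_cancel ?_
  rw [h1]
  rcases x with n | n
  · have h2 := upperPart_add_lowerPart ((lax W ^ (n : ℤ) : TimeMatrixˣ) : TimeMatrix)
    rw [h.flow n, h.bar_flow n, mul_assoc, hWV, ← sub_mul, sub_neg_eq_add, h2, lax_zpow]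
    simp only [flowLeft, flowRight, Sum.elim_inl, map_zero, mul_zero, add_zero, hV, Units.val_mul,
      mul_assoc]
  · have h2 := upperPart_add_lowerPart ((lax Wbar ^ (-(n : ℤ)) : TimeMatrixˣ) : TimeMatrix)
    rw [h.flow_bar n, h.bar_flow_bar n, mul_assoc, hWV, ← sub_mul, ← neg_add', h2, lax_zpow]
    simp only [flowLeft, flowRight, Sum.elim_inr, map_zero, zero_mul, zero_add]
    rw [← mul_assoc (W : TimeMatrix), hWV, neg_mul, mul_assoc, Wbar.inv_mul, mul_one, map_neg,
      mul_neg]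

theorem flow_unique (hħ : ħ ≠ 0) {V V' : TimeMatrix}
    (hV : ∀ x, ħ • timeDeriv x V = C (flowLeft x) * V + V * C (flowRight x))
    (hV' : ∀ x, ħ • timeDeriv x V' = C (flowLeft x) * V' + V' * C (flowRight x))
    (h : constantCoeff V = constantCoeff V') : V = V' := by
  refine sub_eq_zero.1 (eq_zero_of_flow hħ (a := flowLeft) (b := flowRight) (fun x => ?_) ?_)
  · rw [timeDeriv_sub, smul_sub, hV, hV', mul_sub, sub_mul]
    abel
  · rw [map_sub, h, sub_self]

theorem IsTodaSolution.unique (hħ : ħ ≠ 0) {W' Wbar' : TimeMatrixˣ}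
    (h : IsTodaSolution ħ U W Wbar) (h' : IsTodaSolution ħ U W' Wbar') : W = W' ∧ Wbar = Wbar' := by
  have hV : W⁻¹ * Wbar = W'⁻¹ * Wbar' := Units.ext (flow_unique hħ h.ratio_flow
    h'.ratio_flow (h.initial.trans h'.initial.symm))
  -- The common value is lower triangular with unit diagonal and also upper triangular.
  have hR : W' * W⁻¹ = Wbar' * Wbar⁻¹ := by
    rw [eq_mul_inv_iff_mul_eq, mul_assoc, hV, mul_inv_cancel_left]
  have hW := isUnitLower_iff.1 h.lower
  have hW' := isUnitLower_iff.1 h'.lower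
  have h1 : ((W' * W⁻¹ : TimeMatrixˣ) : TimeMatrix) - 1 ∈ coeffsIn (BandMatrix.below (-1)) := by
    have h2 : ((W' * W⁻¹ : TimeMatrixˣ) : TimeMatrix) - 1 =
        (((W' : TimeMatrix) - 1) - ((W : TimeMatrix) - 1)) *
          ((W⁻¹ : TimeMatrixˣ) : TimeMatrix) := by
      rw [sub_sub_sub_cancel_right, sub_mul, W.mul_inv, Units.val_mul]
    rw [h2]
    exact mul_mem_coeffsIn (fun a ha b hb => BandMatrix.mul_mem_below ha hb (by norm_num))
      (sub_mem hW' hW) (inv_mem_coeffsIn_below W hW)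
  have h2 : ((W' * W⁻¹ : TimeMatrixˣ) : TimeMatrix) - 1 ∈ coeffsIn BandMatrix.upper := by
    rw [hR, Units.val_mul]
    exact sub_mem (mul_mem_coeffsIn (fun a ha b hb => BandMatrix.mul_mem_upper ha hb) h'.upper
      h.upper_inv)
      (map_one (C : BandMatrix →+* TimeMatrix) ▸ C_mem_coeffsIn BandMatrix.one_mem_upper)
  have h3 : W' * W⁻¹ = 1 := Units.ext (sub_eq_zero.1 (by
    ext1 m
    exact BandMatrix.eq_zero_of_mem_below_of_mem_upper (h1 m) (h2 m)))
  exact ⟨(mul_inv_eq_one.1 h3).symm, (mul_inv_eq_one.1 (hR ▸ h3)).symm⟩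

theorem existsUnique_isTodaSolution (hħ : ħ ≠ 0) (hU : ∀ i j, i < j → U i j = 0)
    (hd : ∀ j, U j j ≠ 0) : ∃! D : TimeMatrixˣ × TimeMatrixˣ, IsTodaSolution ħ U D.1 D.2 := by
  have hc := constantCoeff_evolution ħ U
  obtain ⟨W, Wbar, h1, h2, h3, h4⟩ := exists_factorization (V := evolution ħ U)
    (hc.symm ▸ fun i j h => hU i j (by omega)) (hc.symm ▸ hd)
  have h5 := isTodaSolution_of_factorization (evolution_flow hħ U) h1 h2 h3 h4
  rw [hc] at h5
  refine ⟨(W, Wbar), h5, fun D hD => ?_⟩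
  have h6 := hD.unique hħ h5
  exact Prod.ext h6.1 h6.2

end Solution

/-! ### The string equations -/

/-- `A V = V B` persists along the flows if `A` and `B` obey the corresponding Lax equations. -/
theorem intertwining_of_constantCoeff {ħ : ℝ} (hħ : ħ ≠ 0) {V A B : TimeMatrix}
    (hV : ∀ x, ħ • timeDeriv x V = C (flowLeft x) * V + V * C (flowRight x))
    (hA : ∀ x, ħ • timeDeriv x A = C (flowLeft x) * A - A * C (flowLeft x))
    (hB : ∀ x, ħ • timeDeriv x B = B * C (flowRight x) - C (flowRight x) * B)
    (h0 : constantCoeff A * constantCoeff V = constantCoeff V * constantCoeff B) :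
    A * V = V * B := by
  refine sub_eq_zero.1 (eq_zero_of_flow hħ (a := flowLeft) (b := flowRight) (fun x => ?_) ?_)
  · rw [timeDeriv_sub, timeDeriv_mul, timeDeriv_mul, smul_sub, smul_add, smul_add,
      ← smul_mul_assoc, ← mul_smul_comm, ← smul_mul_assoc, ← mul_smul_comm, hV, hA, hB]
    noncomm_ring
  · rw [map_sub, map_mul, map_mul, h0, sub_self]

theorem constantCoeff_delta : constantCoeff TimeMatrix.delta = BandMatrix.delta :=
  constantCoeff_C _

theorem timeDeriv_delta (x : Time) : timeDeriv x TimeMatrix.delta = 0 := timeDeriv_C x _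

theorem C_smul (c : ℝ) (a : BandMatrix) : (C (c • a) : TimeMatrix) = c • C a := by
  classical
  ext1 m
  rw [TimeMatrix.coeff_smul, coeff_C, coeff_C]
  split_ifs
  · rfl
  · rw [smul_zero]

theorem C_shift_mul_delta (k : ℤ) :
    (C ((BandMatrix.shift ^ k : BandMatrixˣ) : BandMatrix) : TimeMatrix) * TimeMatrix.delta =
      TimeMatrix.delta * C ((BandMatrix.shift ^ k : BandMatrixˣ) : BandMatrix) +
        (k : ℝ) • C ((BandMatrix.shift ^ k : BandMatrixˣ) : BandMatrix) := by
  rw [TimeMatrix.delta, ← map_mul, BandMatrix.shift_zpow_mul_delta, map_add, map_mul, C_smul]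

theorem shift_zpow_commute (k l : ℤ) :
    ((BandMatrix.shift ^ k : BandMatrixˣ) : BandMatrix) *
        ((BandMatrix.shift ^ l : BandMatrixˣ) : BandMatrix) =
      ((BandMatrix.shift ^ l : BandMatrixˣ) : BandMatrix) *
        ((BandMatrix.shift ^ k : BandMatrixˣ) : BandMatrix) := by
  rw [← Units.val_mul, ← Units.val_mul, ← zpow_add, ← zpow_add, add_comm]

theorem C_shift_zpow_commute (k l : ℤ) :
    (C ((BandMatrix.shift ^ k : BandMatrixˣ) : BandMatrix) : TimeMatrix) *
        C ((BandMatrix.shift ^ l : BandMatrixˣ) : BandMatrix) =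
      C ((BandMatrix.shift ^ l : BandMatrixˣ) : BandMatrix) *
        C ((BandMatrix.shift ^ k : BandMatrixˣ) : BandMatrix) := by
  rw [← map_mul, shift_zpow_commute, map_mul]

theorem timeSum_commute (k : ℤ) :
    timeSum * C ((BandMatrix.shift ^ k : BandMatrixˣ) : BandMatrix) =
      C ((BandMatrix.shift ^ k : BandMatrixˣ) : BandMatrix) * timeSum :=
  linearSeries_commute fun x => by
    rcases x with n | n
    · simp only [Sum.elim_inl, smul_mul_assoc, mul_smul_comm, shift_zpow_commute]
    · simp

theorem timeSumBar_commute (k : ℤ) :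
    timeSumBar * C ((BandMatrix.shift ^ k : BandMatrixˣ) : BandMatrix) =
      C ((BandMatrix.shift ^ k : BandMatrixˣ) : BandMatrix) * timeSumBar :=
  linearSeries_commute fun x => by
    rcases x with n | n
    · simp
    · simp only [Sum.elim_inr, smul_mul_assoc, mul_smul_comm, shift_zpow_commute]

/-- The Lax equation of the undressed operator `(ħ Δ + ∑ n tₙ Λⁿ) Λᵏ`. -/
theorem orlov_base_lax (ħ : ℝ) (k : ℤ) (x : Time) :
    ħ • timeDeriv x ((ħ • TimeMatrix.delta + timeSum) *
        C ((BandMatrix.shift ^ k : BandMatrixˣ) : BandMatrix)) =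
      C (flowLeft x) * ((ħ • TimeMatrix.delta + timeSum) *
          C ((BandMatrix.shift ^ k : BandMatrixˣ) : BandMatrix)) -
        ((ħ • TimeMatrix.delta + timeSum) *
          C ((BandMatrix.shift ^ k : BandMatrixˣ) : BandMatrix)) * C (flowLeft x) := by
  rw [timeDeriv_mul, timeDeriv_C, mul_zero, add_zero, timeDeriv_add, timeDeriv_smul,
    timeDeriv_delta, smul_zero, zero_add]
  rw [show timeDeriv x timeSum = _ from timeDeriv_linearSeries x _]
  rcases x with n | n
  · simp only [flowLeft, Sum.elim_inl]
    rw [mul_assoc _ (C _) (C _), C_shift_zpow_commute k, ← mul_assoc, ← mul_assoc, ← sub_mul,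
      mul_add, add_mul _ timeSum, ← timeSum_commute, add_sub_add_right_eq_sub, mul_smul_comm,
      smul_mul_assoc, C_shift_mul_delta, smul_add, add_sub_cancel_left, C_smul]
    simp only [smul_mul_assoc, Int.cast_natCast]
  · simp [flowLeft]

/-- The Lax equation of the undressed operator `(ħ Δ - ∑ n t̄ₙ Λ⁻ⁿ) Λᵏ`. -/
theorem orlovBar_base_lax (ħ : ℝ) (k : ℤ) (x : Time) :
    ħ • timeDeriv x ((ħ • TimeMatrix.delta - timeSumBar) *
        C ((BandMatrix.shift ^ k : BandMatrixˣ) : BandMatrix)) =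
      ((ħ • TimeMatrix.delta - timeSumBar) *
          C ((BandMatrix.shift ^ k : BandMatrixˣ) : BandMatrix)) * C (flowRight x) -
        C (flowRight x) * ((ħ • TimeMatrix.delta - timeSumBar) *
          C ((BandMatrix.shift ^ k : BandMatrixˣ) : BandMatrix)) := by
  rw [timeDeriv_mul, timeDeriv_C, mul_zero, add_zero, timeDeriv_sub, timeDeriv_smul,
    timeDeriv_delta, smul_zero, zero_sub]
  rw [show timeDeriv x timeSumBar = _ from timeDeriv_linearSeries x _]
  rcases x with n | n
  · simp [flowRight]
  · simp only [flowRight, Sum.elim_inr, map_neg, mul_neg, neg_mul, sub_neg_eq_add]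
    rw [mul_assoc _ (C _) (C _), C_shift_zpow_commute k, ← mul_assoc, ← mul_assoc, neg_add_eq_sub,
      ← sub_mul, mul_sub, sub_mul _ timeSumBar, ← timeSumBar_commute, sub_sub_sub_cancel_right,
      mul_smul_comm, smul_mul_assoc, C_shift_mul_delta, smul_add, add_sub_cancel_left, C_smul]
    simp only [smul_mul_assoc, neg_mul, Int.cast_neg, Int.cast_natCast, neg_smul, smul_neg]

theorem shift_zpow_flowLeft (k : ℤ) (x : Time) :
    (C ((BandMatrix.shift ^ k : BandMatrixˣ) : BandMatrix) : TimeMatrix) * C (flowLeft x) =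
      C (flowLeft x) * C ((BandMatrix.shift ^ k : BandMatrixˣ) : BandMatrix) := by
  rcases x with n | n
  · exact C_shift_zpow_commute _ _
  · simp [flowLeft]

theorem shift_zpow_flowRight (k : ℤ) (x : Time) :
    (C ((BandMatrix.shift ^ k : BandMatrixˣ) : BandMatrix) : TimeMatrix) * C (flowRight x) =
      C (flowRight x) * C ((BandMatrix.shift ^ k : BandMatrixˣ) : BandMatrix) := by
  rcases x with n | n
  · simp [flowRight]
  · simp only [flowRight, Sum.elim_inr, map_neg, mul_neg, neg_mul, C_shift_zpow_commute k]

section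

variable {p : ℕ} {ħ : ℝ} {U : BandMatrix} {W Wbar : TimeMatrixˣ}

/-- The first string equation, from the relation `Λᵖ U = U (ħ Δ Λ⁻¹ + Λᵖ)` at `t = t̄ = 0`. -/
theorem IsTodaSolution.string_equation (hħ : ħ ≠ 0) (h : IsTodaSolution ħ U W Wbar)
    (hU : ((BandMatrix.shift ^ p : BandMatrixˣ) : BandMatrix) * U =
      U * (ħ • (BandMatrix.delta * ((BandMatrix.shift⁻¹ : BandMatrixˣ) : BandMatrix)) +
        ((BandMatrix.shift ^ p : BandMatrixˣ) : BandMatrix))) :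
    ((lax W ^ p : TimeMatrixˣ) : TimeMatrix) =
      orlovBar ħ Wbar * (((lax Wbar)⁻¹ : TimeMatrixˣ) : TimeMatrix) +
        ((lax Wbar ^ p : TimeMatrixˣ) : TimeMatrix) := by
  have key := intertwining_of_constantCoeff hħ
    (A := C ((BandMatrix.shift ^ (p : ℤ) : BandMatrixˣ) : BandMatrix))
    (B := (ħ • TimeMatrix.delta - timeSumBar) *
      C ((BandMatrix.shift ^ (-1 : ℤ) : BandMatrixˣ) : BandMatrix) +
        C ((BandMatrix.shift ^ (p : ℤ) : BandMatrixˣ) : BandMatrix)) h.ratio_flow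
    (fun x => by rw [timeDeriv_C, smul_zero, shift_zpow_flowLeft, sub_self])
    (fun x => by
      rw [timeDeriv_add, timeDeriv_C, add_zero, orlovBar_base_lax, add_mul, mul_add,
        shift_zpow_flowRight]
      abel)
    (by
      rw [h.initial, map_add, map_mul, map_sub, constantCoeff_real_smul, constantCoeff_delta,
        timeSumBar, constantCoeff_linearSeries, constantCoeff_C, constantCoeff_C, sub_zero,
        smul_mul_assoc, zpow_neg_one, zpow_natCast, hU])
  have hWW : (Wbar : TimeMatrix) * ((Wbar⁻¹ : TimeMatrixˣ) : TimeMatrix) = 1 := Wbar.mul_inv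
  have key2 := congrArg (fun X => (W : TimeMatrix) * X *
    ((Wbar⁻¹ : TimeMatrixˣ) : TimeMatrix)) key
  simp only [Units.val_mul, mul_assoc, Units.mul_inv_cancel_left, hWW, mul_one] at key2
  rw [← zpow_natCast (lax W), ← zpow_natCast (lax Wbar), ← zpow_neg_one, lax_zpow, lax_zpow,
    lax_zpow, orlovBar]
  simp only [mul_assoc, Units.inv_mul_cancel_left]
  rw [key2, add_mul, mul_add]
  simp only [mul_assoc]

/-- The second string equation, from the relation
`U Λ = (-ħ/p Δ Λ⁻ᵖ + c Λ⁻ᵖ + Λ) U` at `t = t̄ = 0`. -/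
theorem IsTodaSolution.string_equation_bar (hħ : ħ ≠ 0) (h : IsTodaSolution ħ U W Wbar)
    (hU : U * (BandMatrix.shift : BandMatrix) =
      (-(ħ / p) • (BandMatrix.delta *
          ((BandMatrix.shift ^ (-(p : ℤ)) : BandMatrixˣ) : BandMatrix)) +
        (ħ * ((p - 1) / (2 * p))) •
          ((BandMatrix.shift ^ (-(p : ℤ)) : BandMatrixˣ) : BandMatrix) +
        (BandMatrix.shift : BandMatrix)) * U) :
    (lax Wbar : TimeMatrix) =
      -(1 / (p : ℝ)) • (orlov ħ W * ((lax W ^ (-(p : ℤ)) : TimeMatrixˣ) : TimeMatrix)) +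
        (ħ * (((p : ℝ) - 1) / (2 * p))) •
          ((lax W ^ (-(p : ℤ)) : TimeMatrixˣ) : TimeMatrix) +
        (lax W : TimeMatrix) := by
  have key := intertwining_of_constantCoeff hħ
    (A := -(1 / (p : ℝ)) • ((ħ • TimeMatrix.delta + timeSum) *
        C ((BandMatrix.shift ^ (-(p : ℤ)) : BandMatrixˣ) : BandMatrix)) +
      (ħ * (((p : ℝ) - 1) / (2 * p))) •
        C ((BandMatrix.shift ^ (-(p : ℤ)) : BandMatrixˣ) : BandMatrix) +
      C ((BandMatrix.shift ^ (1 : ℤ) : BandMatrixˣ) : BandMatrix))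
    (B := C ((BandMatrix.shift ^ (1 : ℤ) : BandMatrixˣ) : BandMatrix)) h.ratio_flow
    (fun x => by
      rw [timeDeriv_add, timeDeriv_add, timeDeriv_C, add_zero, timeDeriv_smul, timeDeriv_smul,
        timeDeriv_C, smul_zero, add_zero, smul_comm, orlov_base_lax]
      generalize (ħ • TimeMatrix.delta + timeSum) * _ = P
      simp only [add_mul, mul_add, smul_mul_assoc, mul_smul_comm, shift_zpow_flowLeft, smul_sub]
      abel)
    (fun x => by rw [timeDeriv_C, smul_zero, shift_zpow_flowRight, sub_self])
    (by
      rw [h.initial, map_add, map_add, constantCoeff_real_smul, constantCoeff_real_smul, map_mul,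
        map_add, constantCoeff_real_smul, constantCoeff_delta, timeSum, constantCoeff_linearSeries,
        constantCoeff_C, constantCoeff_C, add_zero, smul_mul_assoc, zpow_one, hU, smul_smul]
      congr 4
      ring)
  have hWW : (Wbar : TimeMatrix) * ((Wbar⁻¹ : TimeMatrixˣ) : TimeMatrix) = 1 := Wbar.mul_inv
  have key2 := congrArg (fun X => (W : TimeMatrix) * X *
    ((Wbar⁻¹ : TimeMatrixˣ) : TimeMatrix)) key
  simp only [Units.val_mul, mul_assoc, Units.mul_inv_cancel_left, hWW, mul_one] at key2
  rw [← zpow_one (lax Wbar), ← zpow_one (lax W), ← zpow_mul, one_mul, lax_zpow, lax_zpow, lax_zpow,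
    orlov]
  simp only [mul_assoc, Units.inv_mul_cancel_left]
  rw [← key2]
  simp only [add_mul, mul_add, smul_mul_assoc, mul_smul_comm, mul_assoc]

end

end Toda

end

open Toda Toda.TimeMatrix in
theorem mainTheorem3 (p : ℕ) (hp : 1 ≤ p) (ħ κ : ℝ) (hħ : 0 < ħ) (hκ : κ ≠ 0) :
    ∃ U : BandMatrix,
      -- `U` is the matrix of asymptotic coefficients, for every cut-off `ε` and every integer `j`
      (∀ ε > 0, ∀ j : ℤ, HasGKExpansion p ħ κ (Set.Ioi ε) U j) ∧
      (Odd p → ∀ j < 0, HasGKExpansion p ħ κ Set.univ U j) ∧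
      (∀ ε > 0, ∀ U' : BandMatrix, (∀ j : ℤ, HasGKExpansion p ħ κ (Set.Ioi ε) U' j) → U' = U) ∧
      -- the linear relations
      ((BandMatrix.shift ^ p : BandMatrixˣ) : BandMatrix) * U =
        U * (ħ • (BandMatrix.delta * ((BandMatrix.shift⁻¹ : BandMatrixˣ) : BandMatrix)) +
          ((BandMatrix.shift ^ p : BandMatrixˣ) : BandMatrix)) ∧
      U * (BandMatrix.shift : BandMatrix) =
        (-(ħ / p) • (BandMatrix.delta *
            ((BandMatrix.shift ^ (-(p : ℤ)) : BandMatrixˣ) : BandMatrix)) +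
          (ħ * ((p - 1) / (2 * p))) •
            ((BandMatrix.shift ^ (-(p : ℤ)) : BandMatrixˣ) : BandMatrix) +
          (BandMatrix.shift : BandMatrix)) * U ∧
      -- there is exactly one solution of the Toda lattice hierarchy with this `U(0,0)`
      (∃! D : TimeMatrixˣ × TimeMatrixˣ, IsTodaSolution ħ U D.1 D.2) ∧
      -- the string equations
      ∀ W Wbar : TimeMatrixˣ, IsTodaSolution ħ U W Wbar →
        ((lax W ^ p : TimeMatrixˣ) : TimeMatrix) =
          orlovBar ħ Wbar * (((lax Wbar)⁻¹ : TimeMatrixˣ) : TimeMatrix) +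
            ((lax Wbar ^ p : TimeMatrixˣ) : TimeMatrix) ∧
        (lax Wbar : TimeMatrix) =
          -(1 / (p : ℝ)) • (orlov ħ W * ((lax W ^ (-(p : ℤ)) : TimeMatrixˣ) : TimeMatrix)) +
            (ħ * (((p : ℝ) - 1) / (2 * p))) •
              ((lax W ^ (-(p : ℤ)) : TimeMatrixˣ) : TimeMatrix) +
            (lax W : TimeMatrix) := by
  have hd := gkMatrix_diag_ne_zero (ħ := ħ) (κ := κ) hp hħ hκ
  have h1 := shift_pow_mul_gkMatrix ħ κ hp
  have h2 := gkMatrix_mul_shift ħ κ hp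
  exact ⟨gkMatrix p ħ κ, fun _ hε j => hasGKExpansion_Ioi hp hħ κ hε j,
    fun hodd _ hj => hasGKExpansion_univ hodd hħ κ hj,
    fun _ hε _ hU' => gkMatrix_unique hU' fun j => hasGKExpansion_Ioi hp hħ κ hε j,
    h1, h2, existsUnique_isTodaSolution hħ.ne' (fun _ _ h => gkMatrix_lower h) hd,
    fun _ _ h => ⟨h.string_equation hħ.ne' h1, h.string_equation_bar hħ.ne' h2⟩⟩
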